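/- Let $(X,\mathcal X,\mu)$ be a standard Borel probability space. For a measure preserving map $T$ of $X$ define probability measures $\mu_T^{[k]}$ on $X^{[k]}=X^{2^k}$ (coordinates indexed by $\{0,1\}^k$) by $\mu_T^{[0]}=\mu$ and by letting $\mu_T^{[k+1]}$ be the relatively independent square of $\mu_T^{[k]}$ over the $\sigma$-algebra $\mathcal I^{[k]}(T)$ of measurable subsets of $X^{[k]}$ invariant under $T\times\cdots\times T$ ($2^k$ times), i.e. $$\int F'(\mathbf x')F''(\mathbf x'')\,d\mu_T^{[k+1]}(\mathbf x',\mathbf x'')=\int \mathbb E(F'\mid\mathcal I^{[k]}(T))\,\mathbb E(F''\mid\mathcal I^{[k]}(T))\,d\mu_T^{[k]}$$ for bounded measurable $F',F''$. For real valued $f\in L^\infty(\mu)$ and $k\ge1$ put $$|||f|||_{k,T}=\Big(\int_{X^{[k]}}\prod_{\epsilon\in\{0,1\}^k}f(x_\epsilon)\,d\mu_T^{[k]}(\mathbf x)\Big)^{1/2^k},$$ and let $\mathcal Z_{k-1}(X,T)$ be the $\sigma$-algebra of all $A\in\mathcal X$ for which there is a measurable set $B\subset X^{\{0,1\}^k\setminus\{0\cdots0\}}$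 such that $1_A(x_{0\cdots 0})=1_B((x_\epsilon)_{\epsilon\ne 0\cdots0})$ for $\mu_T^{[k]}$-almost every $\mathbf x$. Let $l\ge1$ and let $T_1,\dots,T_l$ be commuting invertible ergodic measure preserving transformations of $(X,\mathcal X,\mu)$ such that $T_iT_j^{-1}$ is ergodic for all $i\ne j$. Let $j\in\{1,\dots,l\}$ be arbitrary. (i) For all real valued $f_1,\dots,f_l\in L^\infty(\mu)$, $$\limsup_{N\to\infty}\Big\|\frac1N\sum_{n=0}^{N-1}f_1(T_1^nx)\cdots f_l(T_l^nx)\Big\|_{L^2(\mu)}\le\min_{1\le i\le l}\Big(|||f_i|||_{l,T_j}\prod_{m\ne i}\|f_m\|_{L^\infty(\mu)}\Big).$$ In particular, if $\|f_m\|_{L^\infty(\mu)}\le1$ for all $m$, then the limsup is at most $\min_{1\le i\le l}|||f_i|||_{l,T_j}$. (ii) The $\sigma$-algebra $\mathcal Z=\mathcal Z_{l-1}(X,T_j)$ satisfies, for $f\in L^\infty(\mu)$, $\mathbb E(f\mid\mathcal Z)=0$ if and only if $|||f|||_{l,T_j}=0$, and it is a characteristic factor for these averages: $T_i^{-1}\mathcal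 Z=\mathcal Z$ for all $i$, and for all $f_1,\dots,f_l\in L^\infty(\mu)$ such that $\mathbb E(f_i\mid\mathcal Z)=0$ for some $i$, the averages $\frac1N\sum_{n=0}^{N-1}f_1(T_1^nx)\cdots f_l(T_l^nx)$ converge to $0$ in $L^2(\mu)$. -/

import Mathlib

open MeasureTheory ProbabilityTheory Filter Topology
open scoped ENNReal

namespace HostKra

/-- The relatively independent square of `ν` over the sub-σ-algebra `m`: the measure
`∫ (ν_ω × ν_ω) dν(ω)`, where `ν_ω` is the disintegration of `ν` over `m`. -/
noncomputable def relIndepSquare {Ω : Type*} (m : MeasurableSpace Ω) [mΩ : MeasurableSpace Ω]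
    [StandardBorelSpace Ω] (ν : Measure Ω) [IsFiniteMeasure ν] : Measure (Ω × Ω) :=
  ν.bind (fun ω => (condExpKernel ν m ω).prod (condExpKernel ν m ω))

theorem measurable_condExpKernel_prod {Ω : Type*} {m : MeasurableSpace Ω} [mΩ : MeasurableSpace Ω]
    [StandardBorelSpace Ω] (ν : Measure Ω) [IsFiniteMeasure ν]
    (hm : m ≤ mΩ) :
    Measurable (fun ω => (condExpKernel ν m ω).prod (condExpKernel ν m ω)) := by
  have h : Measurable[m]
      (fun ω => (condExpKernel ν m ω).prod (condExpKernel ν m ω)) := by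
    have h2 := ((condExpKernel ν m) ×ₖ (condExpKernel ν m)).measurable
    have h3 : (fun ω => (condExpKernel ν m ω).prod (condExpKernel ν m ω))
        = ⇑((condExpKernel ν m) ×ₖ (condExpKernel ν m)) := by
      funext ω
      rw [Kernel.prod_apply]
    rw [h3]
    exact h2
  exact h.mono hm le_rfl

theorem isProbabilityMeasure_relIndepSquare {Ω : Type*} {m : MeasurableSpace Ω} [mΩ : MeasurableSpace Ω]
    [StandardBorelSpace Ω] (ν : Measure Ω) [IsProbabilityMeasure ν]
    (hm : m ≤ mΩ) : IsProbabilityMeasure (relIndepSquare m ν) := by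
  constructor
  rw [relIndepSquare, Measure.bind_apply MeasurableSet.univ
    (measurable_condExpKernel_prod ν hm).aemeasurable]
  simp

/-- The defining identity of the relatively independent square: the integral of
`F'(x') F''(x'')` is the integral of the product of the conditional expectations. -/
theorem integral_relIndepSquare {Ω : Type*} {m : MeasurableSpace Ω} [mΩ : MeasurableSpace Ω]
    [StandardBorelSpace Ω] (ν : Measure Ω) [IsProbabilityMeasure ν]
    (hm : m ≤ mΩ) {F G : Ω → ℝ} (hF : Measurable F) (hG : Measurable G)
    {C D : ℝ} (hC : ∀ ω, ‖F ω‖ ≤ C) (hD : ∀ ω, ‖G ω‖ ≤ D) :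
    ∫ p, F p.1 * G p.2 ∂(relIndepSquare m ν) = ∫ ω, (ν[F | m]) ω * (ν[G | m]) ω ∂ν := by
  have := isProbabilityMeasure_relIndepSquare ν hm
  have hFi : Integrable F ν := Integrable.of_bound hF.aestronglyMeasurable C (ae_of_all _ hC)
  have hGi : Integrable G ν := Integrable.of_bound hG.aestronglyMeasurable D (ae_of_all _ hD)
  have hint : Integrable (fun p : Ω × Ω => F p.1 * G p.2) (relIndepSquare m ν) := by
    refine Integrable.of_bound (by fun_prop) (C * D) (ae_of_all _ fun p => ?_)
    rw [norm_mul]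
    exact mul_le_mul (hC _) (hD _) (norm_nonneg _) ((norm_nonneg _).trans (hC p.1))
  rw [relIndepSquare] at hint ⊢
  have hbind := Kernel.integral_comp (κ := Kernel.const Unit ν)
    (η := ⟨_, measurable_condExpKernel_prod ν hm⟩) (a := ()) (f := fun p => F p.1 * G p.2)
    (by rw [Kernel.comp_apply, Kernel.const_apply]; exact hint)
  rw [Kernel.comp_apply, Kernel.const_apply] at hbind
  refine hbind.trans ?_
  refine integral_congr_ae ?_
  filter_upwards [condExp_ae_eq_integral_condExpKernel hm hFi,
    condExp_ae_eq_integral_condExpKernel hm hGi] with ω h1 h2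
  rw [h1, h2]
  exact integral_prod_mul F G

/-- The cube space `X^{[k]} = X^{2^k}`, with coordinates indexed by `V_k = {0,1}^k`. -/
abbrev Cube (X : Type*) (k : ℕ) : Type _ := (Fin k → Bool) → X

/-- The map `T^{[k]} = T × ⋯ × T` on `X^{[k]}`. -/
def cubeMap {X : Type*} (T : X → X) (k : ℕ) : Cube X k → Cube X k :=
  fun x ε => T (x ε)

/-- The identification `X^{[k]} × X^{[k]} → X^{[k+1]}`, `(x', x'') ↦ x`, where `x_{ε0} = x'_ε`
and `x_{ε1} = x''_ε`. -/
def cubeGlue {X : Type*} (k : ℕ) (p : Cube X k × Cube X k) : Cube X (k + 1) :=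
  fun ε => bif ε (Fin.last k) then p.2 (fun i => ε i.castSucc) else p.1 (fun i => ε i.castSucc)

theorem measurable_cubeGlue {X : Type*} [MeasurableSpace X] (k : ℕ) :
    Measurable (cubeGlue (X := X) k) := by
  refine measurable_pi_lambda _ fun ε => ?_
  unfold cubeGlue
  cases ε (Fin.last k)
  · exact (measurable_pi_apply _).comp measurable_fst
  · exact (measurable_pi_apply _).comp measurable_snd

/-- The measures `μ^{[k]}` on `X^{[k]}`, bundled with the fact that they are probability measures:
`μ^{[0]} = μ`, and `μ^{[k+1]}` is the relatively independent square of `μ^{[k]}` over the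
σ-algebra of `T^{[k]}`-invariant sets. -/
noncomputable def cubeProb {X : Type*} [MeasurableSpace X] [StandardBorelSpace X]
    (T : X → X) (μ : Measure X) [IsProbabilityMeasure μ] :
    (k : ℕ) → {ν : Measure (Cube X k) // IsProbabilityMeasure ν}
  | 0 => ⟨μ.map (fun x _ => x), Measure.isProbabilityMeasure_map
      (measurable_pi_lambda _ fun _ => measurable_id).aemeasurable⟩
  | k + 1 =>
    haveI := (cubeProb T μ k).2
    haveI := isProbabilityMeasure_relIndepSquare (cubeProb T μ k).1
      (MeasurableSpace.invariants_le (cubeMap T k))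
    ⟨(relIndepSquare (MeasurableSpace.invariants (cubeMap T k)) (cubeProb T μ k).1).map
        (cubeGlue k),
      Measure.isProbabilityMeasure_map (measurable_cubeGlue k).aemeasurable⟩

/-- The measure `μ_T^{[k]}` on `X^{[k]}`. -/
noncomputable def cubeMeasure {X : Type*} [MeasurableSpace X] [StandardBorelSpace X]
    (T : X → X) (μ : Measure X) [IsProbabilityMeasure μ] (k : ℕ) : Measure (Cube X k) :=
  (cubeProb T μ k).1

/-- The seminorm `|||f|||_{k,T}`, the `2^k`-th root of `∫ ∏_ε f(x_ε) dμ_T^{[k]}(x)`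
(for `k ≥ 1` and `f ∈ L^∞(μ)`). -/
noncomputable def seminorm {X : Type*} [MeasurableSpace X] [StandardBorelSpace X]
    (T : X → X) (μ : Measure X) [IsProbabilityMeasure μ] (k : ℕ) (f : X → ℝ) : ℝ :=
  (∫ x, ∏ ε : Fin k → Bool, f (x ε) ∂(cubeMeasure T μ k)) ^ (1 / (2 : ℝ) ^ k)

/-- The vertices of `V_k` other than `00⋯0`. -/
abbrev StarVertex (k : ℕ) : Type := {ε : Fin k → Bool // ε ≠ fun _ => false}

/-- The σ-algebra `Z_k(X,T)`: the measurable sets `A` such that `1_A(x_{00⋯0})` coincides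
`μ_T^{[k+1]}`-almost everywhere with a measurable function `1_B` of the remaining
`2^{k+1} - 1` coordinates. -/
@[reducible]
def factorAlgebra {X : Type*} [MeasurableSpace X] [StandardBorelSpace X]
    (T : X → X) (μ : Measure X) [IsProbabilityMeasure μ] (k : ℕ) : MeasurableSpace X where
  MeasurableSet' A := MeasurableSet A ∧ ∃ B : Set (StarVertex (k + 1) → X), MeasurableSet B ∧
    ∀ᵐ x ∂(cubeMeasure T μ (k + 1)), x (fun _ => false) ∈ A ↔ (fun ε => x ε.1) ∈ B
  measurableSet_empty := ⟨MeasurableSet.empty, ∅, MeasurableSet.empty, by simp⟩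
  measurableSet_compl A := by
    rintro ⟨hA, B, hB, h⟩
    refine ⟨hA.compl, Bᶜ, hB.compl, ?_⟩
    filter_upwards [h] with x hx
    exact not_congr hx
  measurableSet_iUnion A := by
    intro hA
    choose hA B hB h using hA
    refine ⟨MeasurableSet.iUnion hA, ⋃ i, B i, MeasurableSet.iUnion hB, ?_⟩
    filter_upwards [ae_all_iff.2 h] with x hx
    simp only [Set.mem_iUnion]
    exact exists_congr hx

/-- The multiple ergodic average `(1/N) ∑_{n<N} f_1(T_1^n x) ⋯ f_l(T_l^n x)`. -/
noncomputable def multAverage {X : Type*} {l : ℕ} (T : Fin l → X → X) (f : Fin l → X → ℝ)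
    (N : ℕ) (x : X) : ℝ :=
  (1 / (N : ℝ)) * ∑ n ∈ Finset.range N, ∏ i, f i ((T i)^[n] x)

/-- `Z` is a characteristic factor for `L²(μ)`-convergence of the multiple averages: it is a
sub-σ-algebra with `T_i⁻¹ Z = Z` for every `i`, and the averages tend to `0` in `L²(μ)` as soon as
`E(f_i | Z) = 0` for some `i`. -/
def IsCharacteristic {X : Type*} (Z : MeasurableSpace X) [mX : MeasurableSpace X] {l : ℕ}
    (T : Fin l → X → X) (μ : Measure X) : Prop :=
  Z ≤ mX ∧ (∀ i, Z.comap (T i) = Z) ∧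
    ∀ f : Fin l → X → ℝ, (∀ i, MemLp (f i) ⊤ μ) → (∃ i, μ[f i | Z] =ᵐ[μ] 0) →
      Tendsto (fun N => eLpNorm (multAverage T f N) 2 μ) atTop (𝓝 0)

end HostKra

/-! The norm bound is proved by induction on the number of transformations, and rests on van der
Corput's inequality together with the fact that commuting ergodic transformations have the same cube
measures, hence the same seminorms.

For a single map the bound is the mean ergodic theorem. For more maps, van der Corput
(`eventually_integral_sq_average_le`) reduces the problem to correlations of shifts by `h` and `h'`,
that is, to the products of `g_a(T_a^n x)` with `g_a = f_a ∘ T_a^h · f_a ∘ T_a^h'`. Choose `r ≠ i`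
and substitute away `T_r^n`: what remains is `g_r` integrated against an average for the maps `T_a
T_r⁻¹`, `a ≠ r`. These still commute, are ergodic, and have ergodic quotients `T_a T_b⁻¹`. Induction
gives a bound by the seminorm of `g_i` for `T_i T_r⁻¹`, which is the one for `T_i`. Averaging over
`h, h'` raises the order of the seminorm by one (`exists_average_seminorm_le`).

The comparison of cube measures (`cubeMeasure_eq_and_invariants`) is an induction on the dimension
that also compares the invariant sets. Its core is `ae_prod_comp_eq_of_ergodic_of_commute`, applied
in the fibres of the ergodic decomposition: for `T` ergodic, a `T × T`-invariant `F` gives a map `x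
↦ F(x, ·)` into a separable L¹ space on which `T` acts isometrically, and this rigidity forces
invariance under `S × S`.

For the factor, vanishing of the seminorm makes `f(x_{0⋯0})` orthogonal to all functions of the
other coordinates, by the Cauchy–Schwarz–Gowers inequality, and in particular makes `f` orthogonal
to `Z`. Conversely, the conditional expectation of `f(x_{0⋯0})` on the other coordinates is
invariant under the face maps, hence is also a function of `x_{0⋯0}`, hence is `Z`-measurable; it
vanishes when `E(f | Z) = 0`, and the seminorm with it. -/

namespace HostKra

/-! ### The mean ergodic theorem and the invariant σ-algebra. -/

section MeanErgodic

variable {Ω : Type*} [mΩ : MeasurableSpace Ω] {ν : Measure Ω} {T : Ω → Ω}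

theorem aestronglyMeasurable_invariants_of_comp_ae_eq (hT : MeasurePreserving T ν ν) {g : Ω → ℝ}
    (hg : AEStronglyMeasurable g ν) (h : g ∘ T =ᵐ[ν] g) :
    AEStronglyMeasurable[MeasurableSpace.invariants T] g ν := by
  set g₀ := hg.mk g
  have hg₀ : Measurable g₀ := hg.stronglyMeasurable_mk.measurable
  have h₀ : g₀ ∘ T =ᵐ[ν] g₀ :=
    ((hT.quasiMeasurePreserving.ae_eq_comp hg.ae_eq_mk).symm.trans h).trans hg.ae_eq_mk
  -- The limsup along the orbit does not see a shift, so it is strictly invariant; in `EReal` it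
  -- exists without any bound on `g₀`.
  set u : Ω → EReal := fun x => limsup (fun n => ((g₀ (T^[n] x) : ℝ) : EReal)) atTop
  have hu : Measurable u := Measurable.limsup fun n =>
    (hg₀.comp (hT.measurable.iterate n)).coe_real_ereal
  have huT : ∀ x, u (T x) = u x := fun x => by
    have := limsup_nat_add (fun n => ((g₀ (T^[n] x) : ℝ) : EReal)) 1
    simpa only [Function.iterate_succ_apply] using this
  have hall : ∀ᵐ x ∂ν, ∀ n, g₀ (T^[n] x) = g₀ x := by
    refine ae_all_iff.2 fun n => ?_
    induction n with
    | zero => simp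
    | succ n ih =>
      filter_upwards [(hT.iterate n).quasiMeasurePreserving.ae h₀, ih] with x hx hn
      rw [Function.iterate_succ_apply']
      exact Eq.trans hx hn
  refine ⟨fun x => (u x).toReal, ?_, ?_⟩
  · refine Measurable.stronglyMeasurable ?_
    rw [MeasurableSpace.measurable_invariants_dom]
    refine ⟨hu.ereal_toReal, fun s _ => ?_⟩
    ext x
    simp [huT x]
  · filter_upwards [hall, hg.ae_eq_mk] with x hx hgx
    simp [u, hx, hgx, g₀]

theorem condExp_invariants_comp_ae_eq (F : Ω → ℝ) (T : Ω → Ω) :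
    (ν[F | MeasurableSpace.invariants T]) ∘ T = ν[F | MeasurableSpace.invariants T] :=
  MeasurableSpace.comp_eq_of_measurable_invariants stronglyMeasurable_condExp.measurable

theorem measurable_birkhoffAverage (hT : Measurable T) {F : Ω → ℝ} (hF : Measurable F) (N : ℕ) :
    Measurable (birkhoffAverage ℝ T F N) := by
  have : birkhoffAverage ℝ T F N = fun x => (N : ℝ)⁻¹ • ∑ n ∈ Finset.range N, F (T^[n] x) := rfl
  rw [this]
  exact Measurable.const_smul (M := ℝ)
    (Finset.measurable_sum _ fun n _ => hF.comp (hT.iterate n)) _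

omit mΩ in
theorem abs_birkhoffAverage_le {F : Ω → ℝ} {C : ℝ} (hC : ∀ x, |F x| ≤ C) (N : ℕ) (x : Ω) :
    |birkhoffAverage ℝ T F N x| ≤ C := by
  have hC0 : 0 ≤ C := (abs_nonneg _).trans (hC x)
  have h1 : birkhoffAverage ℝ T F N x = (N : ℝ)⁻¹ * ∑ n ∈ Finset.range N, F (T^[n] x) := rfl
  rcases Nat.eq_zero_or_pos N with rfl | hN
  · simpa [h1] using hC0
  have hN' : (0 : ℝ) < N := by exact_mod_cast hN
  rw [h1, abs_mul, abs_inv, abs_of_pos hN', inv_mul_le_iff₀ hN']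
  refine (Finset.abs_sum_le_sum_abs _ _).trans ?_
  refine (Finset.sum_le_sum fun n _ => hC (T^[n] x)).trans ?_
  simp

theorem memLp_of_abs_le [IsFiniteMeasure ν] {F : Ω → ℝ} (hF : Measurable F) {C : ℝ}
    (hC : ∀ x, |F x| ≤ C) (p : ℝ≥0∞) : MemLp F p ν :=
  MemLp.of_bound hF.aestronglyMeasurable C (ae_of_all _ hC)

theorem memLp_birkhoffAverage (hT : MeasurePreserving T ν ν) {F : Ω → ℝ} (hF : MemLp F 2 ν)
    (N : ℕ) : MemLp (birkhoffAverage ℝ T F N) 2 ν := by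
  have : birkhoffAverage ℝ T F N = (N : ℝ)⁻¹ • fun x => ∑ n ∈ Finset.range N, F (T^[n] x) := rfl
  rw [this]
  exact (memLp_finsetSum _ fun n _ => hF.comp_measurePreserving (hT.iterate n)).const_smul _

/-- Stated for any `K` equal to `lpMeas`, so that it applies to the fixed space of the Koopman
operator, whose equality with `lpMeas` is a theorem and not definitional. -/
theorem coe_orthogonalProjectionOnto_eq_condExpL2 {Ω : Type*} {m : MeasurableSpace Ω}
    [mΩ : MeasurableSpace Ω] {ν : Measure Ω} (hm : m ≤ mΩ)
    (K : Submodule ℝ (Lp ℝ 2 ν)) [K.HasOrthogonalProjection] (hK : K = lpMeas ℝ ℝ m 2 ν)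
    (g : Lp ℝ 2 ν) :
    (K.orthogonalProjectionOnto g : Lp ℝ 2 ν) = (condExpL2 ℝ ℝ hm g : Lp ℝ 2 ν) := by
  subst hK
  have : Fact (m ≤ mΩ) := ⟨hm⟩
  rfl

theorem coeFn_birkhoffAverage_ae_eq (hT : MeasurePreserving T ν ν) {F : Ω → ℝ} (hF : MemLp F 2 ν)
    (U : Lp ℝ 2 ν → Lp ℝ 2 ν) (hU : ∀ g, U g = Lp.compMeasurePreserving T hT g) (N : ℕ) :
    (birkhoffAverage ℝ U _root_.id N hF.toLp : Lp ℝ 2 ν) =ᵐ[ν] birkhoffAverage ℝ T F N := by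
  have hit : ∀ n, U^[n] hF.toLp = (hF.comp_measurePreserving (hT.iterate n)).toLp := by
    intro n
    induction n with
    | zero => rfl
    | succ n ih =>
      rw [Function.iterate_succ_apply', ih, hU, Lp.toLp_compMeasurePreserving]
      rfl
  have : birkhoffAverage ℝ U _root_.id N hF.toLp
    = (N : ℝ)⁻¹ • ∑ n ∈ Finset.range N, U^[n] hF.toLp := rfl
  rw [this]
  refine (Lp.coeFn_smul _ _).trans ?_
  have hs : ∀ᵐ x ∂ν, ∀ n, (U^[n] hF.toLp : Ω → ℝ) x = F (T^[n] x) := by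
    refine ae_all_iff.2 fun n => ?_
    rw [hit]
    exact MemLp.coeFn_toLp _
  have hsum := Lp.coeFn_finsetSum (Finset.range N) (fun n => U^[n] hF.toLp)
  filter_upwards [hs, hsum] with x hx hx2
  simp only [Pi.smul_apply, hx2, Finset.sum_apply, hx]
  rfl

theorem exists_koopman (hT : MeasurePreserving T ν ν) : ∃ U : Lp ℝ 2 ν →L[ℝ] Lp ℝ 2 ν,
    (∀ g, U g = Lp.compMeasurePreserving T hT g) ∧ ‖U‖ ≤ 1 := by
  obtain ⟨V, hV⟩ : ∃ V : Lp ℝ 2 ν →ₗᵢ[ℝ] Lp ℝ 2 ν, ∀ g, V g = Lp.compMeasurePreserving T hT g :=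
    ⟨Lp.compMeasurePreservingₗᵢ ℝ T hT, fun _ => rfl⟩
  exact ⟨V.toContinuousLinearMap, hV, V.norm_toContinuousLinearMap_le⟩

/-- Von Neumann's mean ergodic theorem. -/
theorem tendsto_eLpNorm_birkhoffAverage_sub_condExp [IsFiniteMeasure ν]
    (hT : MeasurePreserving T ν ν) {F : Ω → ℝ} (hF : MemLp F 2 ν) :
    Tendsto (fun N => eLpNorm
      (birkhoffAverage ℝ T F N - ν[F | MeasurableSpace.invariants T]) 2 ν) atTop (𝓝 0) := by
  have hm := MeasurableSpace.invariants_le T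
  obtain ⟨U, hU, hU1⟩ := exists_koopman hT
  -- The fixed vectors of the Koopman operator are the functions measurable for the invariant
  -- σ-algebra, so the projection in the Hilbert space ergodic theorem is the conditional
  -- expectation.
  have hlocus (g) : g ∈ U.eqLocus (1 : Lp ℝ 2 ν →L[ℝ] Lp ℝ 2 ν)
      ↔ g ∈ lpMeas ℝ ℝ (MeasurableSpace.invariants T) 2 ν := by
    rw [mem_lpMeas_iff_aestronglyMeasurable]
    rw [LinearMap.mem_eqLocus, ContinuousLinearMap.coe_coe, ContinuousLinearMap.coe_coe,
      one_apply_eq_self, hU, Lp.ext_iff]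
    have hc := Lp.coeFn_compMeasurePreserving g hT
    constructor
    · intro h
      exact aestronglyMeasurable_invariants_of_comp_ae_eq hT (Lp.aestronglyMeasurable g)
        (hc.symm.trans h)
    · rintro ⟨g', hg', hgg'⟩
      refine hc.trans ((hT.quasiMeasurePreserving.ae_eq_comp hgg').trans ?_)
      rw [MeasurableSpace.comp_eq_of_measurable_invariants hg'.measurable]
      exact hgg'.symm
  have hlim := U.tendsto_birkhoffAverage_orthogonalProjection hU1 hF.toLp
  rw [coe_orthogonalProjectionOnto_eq_condExpL2 hm _ (Submodule.ext hlocus),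
    Lp.tendsto_Lp_iff_tendsto_eLpNorm'] at hlim
  refine hlim.congr fun N => eLpNorm_congr_ae ?_
  exact (coeFn_birkhoffAverage_ae_eq hT hF U hU N).sub (hF.condExpL2_ae_eq_condExp hm)

end MeanErgodic

end HostKra

namespace HostKra

/-! ### Conditional expectations on the invariant σ-algebra, as limits of averages. -/

section MeanErgodic

variable {Ω : Type*} [mΩ : MeasurableSpace Ω] {ν : Measure Ω} {T : Ω → Ω}

theorem tendsto_integral_mul_of_tendsto_eLpNorm {a b : ℕ → Ω → ℝ} {a' b' : Ω → ℝ}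
    (ha : ∀ N, MemLp (a N) 2 ν) (hb : ∀ N, MemLp (b N) 2 ν) (ha' : MemLp a' 2 ν)
    (hb' : MemLp b' 2 ν) (hla : Tendsto (fun N => eLpNorm (a N - a') 2 ν) atTop (𝓝 0))
    (hlb : Tendsto (fun N => eLpNorm (b N - b') 2 ν) atTop (𝓝 0)) :
    Tendsto (fun N => ∫ x, a N x * b N x ∂ν) atTop (𝓝 (∫ x, a' x * b' x ∂ν)) := by
  have key : ∀ {f g : Ω → ℝ} (hf : MemLp f 2 ν) (hg : MemLp g 2 ν),
      ∫ x, f x * g x ∂ν = inner ℝ hf.toLp hg.toLp := by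
    intro f g hf hg
    rw [L2.inner_def]
    refine integral_congr_ae ?_
    filter_upwards [hf.coeFn_toLp, hg.coeFn_toLp] with x h1 h2
    simp [h1, h2, mul_comm]
  rw [← Lp.tendsto_Lp_iff_tendsto_eLpNorm'' a ha a' ha'] at hla
  rw [← Lp.tendsto_Lp_iff_tendsto_eLpNorm'' b hb b' hb'] at hlb
  rw [key ha' hb']
  simp_rw [fun N => key (ha N) (hb N)]
  exact hla.inner hlb

variable [IsFiniteMeasure ν]

theorem tendsto_integral_mul_birkhoffAverage (hT : MeasurePreserving T ν ν) {F G : Ω → ℝ}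
    (hF : MemLp F 2 ν) (hG : MemLp G 2 ν) :
    Tendsto (fun N => ∫ x, G x * birkhoffAverage ℝ T F N x ∂ν) atTop
      (𝓝 (∫ x, G x * (ν[F | MeasurableSpace.invariants T]) x ∂ν)) :=
  tendsto_integral_mul_of_tendsto_eLpNorm (fun _ => hG) (memLp_birkhoffAverage hT hF) hG
    (hF.condExp one_le_two) (by simp) (tendsto_eLpNorm_birkhoffAverage_sub_condExp hT hF)

theorem tendsto_integral_birkhoffAverage_sq (hT : MeasurePreserving T ν ν) {F : Ω → ℝ}
    (hF : MemLp F 2 ν) :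
    Tendsto (fun N => ∫ x, birkhoffAverage ℝ T F N x ^ 2 ∂ν) atTop
      (𝓝 (∫ x, (ν[F | MeasurableSpace.invariants T]) x ^ 2 ∂ν)) := by
  simp_rw [sq]
  have h := tendsto_eLpNorm_birkhoffAverage_sub_condExp hT hF
  exact tendsto_integral_mul_of_tendsto_eLpNorm (memLp_birkhoffAverage hT hF)
    (memLp_birkhoffAverage hT hF) (hF.condExp one_le_two)
    (hF.condExp one_le_two) h h

/-- Composition with `R` commutes with Birkhoff averages of `T`, and these converge in L² to both
sides; `R` need not be invertible. -/
theorem condExp_invariants_comp_of_commute (hT : MeasurePreserving T ν ν) {R : Ω → Ω}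
    (hR : MeasurePreserving R ν ν) (hRT : Function.Commute R T) {F : Ω → ℝ} (hF : MemLp F 2 ν) :
    ν[F ∘ R | MeasurableSpace.invariants T] =ᵐ[ν] ν[F | MeasurableSpace.invariants T] ∘ R := by
  have hFR := hF.comp_measurePreserving hR
  have h1 := tendsto_eLpNorm_birkhoffAverage_sub_condExp hT hFR
  have h2 := tendsto_eLpNorm_birkhoffAverage_sub_condExp hT hF
  have hm1 := memLp_birkhoffAverage hT hFR
  have hm2 := memLp_birkhoffAverage hT hF
  have hav : ∀ N, birkhoffAverage ℝ T (F ∘ R) N = birkhoffAverage ℝ T F N ∘ R := by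
    intro N
    funext x
    simp only [birkhoffAverage, birkhoffSum, Function.comp_apply]
    congr 1
    exact Finset.sum_congr rfl fun n _ => congrArg F ((hRT.iterate_right n) x)
  have hbd : ∀ N, eLpNorm (ν[F ∘ R | MeasurableSpace.invariants T]
      - ν[F | MeasurableSpace.invariants T] ∘ R) 2 ν ≤
      eLpNorm (birkhoffAverage ℝ T (F ∘ R) N - ν[F ∘ R | MeasurableSpace.invariants T]) 2 ν +
      eLpNorm (birkhoffAverage ℝ T F N - ν[F | MeasurableSpace.invariants T]) 2 ν := by
    intro N
    have e2 : eLpNorm (birkhoffAverage ℝ T F N - ν[F | MeasurableSpace.invariants T]) 2 ν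
        = eLpNorm (birkhoffAverage ℝ T (F ∘ R) N
            - ν[F | MeasurableSpace.invariants T] ∘ R) 2 ν := by
      rw [hav, ← eLpNorm_comp_measurePreserving ((hm2 N).sub (hF.condExp one_le_two)).aestronglyMeasurable hR]
      rfl
    rw [e2, eLpNorm_sub_comm (birkhoffAverage ℝ T (F ∘ R) N)]
    refine le_trans (le_of_eq ?_) (eLpNorm_add_le ((hFR.condExp one_le_two).sub (hm1 N)).aestronglyMeasurable
      ((hm1 N).sub ((hF.condExp one_le_two).comp_measurePreserving hR)).aestronglyMeasurable one_le_two)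
    congr 1
    abel
  have hlim : Tendsto (fun _ : ℕ => eLpNorm (ν[F ∘ R | MeasurableSpace.invariants T]
      - ν[F | MeasurableSpace.invariants T] ∘ R) 2 ν) atTop (𝓝 0) := by
    refine tendsto_of_tendsto_of_tendsto_of_le_of_le tendsto_const_nhds ?_ (fun _ => zero_le)
      hbd
    simpa using h1.add h2
  have h0 := tendsto_nhds_unique hlim tendsto_const_nhds
  rw [eq_comm, eLpNorm_eq_zero_iff ((hFR.condExp one_le_two).sub
    ((hF.condExp one_le_two).comp_measurePreserving hR)).aestronglyMeasurable two_ne_zero] at h0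
  filter_upwards [h0] with x hx
  simpa [sub_eq_zero] using hx

theorem condExp_invariants_comp_self (hT : MeasurePreserving T ν ν) {F : Ω → ℝ}
    (hF : MemLp F 2 ν) :
    ν[F ∘ T | MeasurableSpace.invariants T] =ᵐ[ν] ν[F | MeasurableSpace.invariants T] := by
  have h := condExp_invariants_comp_of_commute hT hT (Function.Commute.refl T) hF
  rwa [condExp_invariants_comp_ae_eq] at h

omit [IsFiniteMeasure ν] in
theorem comp_ae_eq_of_forall_preimage_ae_eq {S : Ω → Ω} {m : MeasurableSpace Ω}
    (h : ∀ A, MeasurableSet[m] A → S ⁻¹' A =ᵐ[ν] A) {g : Ω → ℝ} (hg : Measurable[m] g) :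
    g ∘ S =ᵐ[ν] g := by
  have h1 : ∀ᵐ x ∂ν, ∀ q : ℚ, g (S x) < q ↔ g x < q := by
    refine ae_all_iff.2 fun q => ?_
    have := h (g ⁻¹' Set.Iio (q : ℝ)) (hg measurableSet_Iio)
    filter_upwards [this.mem_iff] with x hx
    exact hx
  filter_upwards [h1] with x hx
  exact eq_of_forall_lt_rat_iff_lt hx

/-- Conditional expectations only see a σ-algebra up to null sets, and the two invariant σ-algebras
agree in that sense. -/
theorem condExp_invariants_congr {S : Ω → Ω} (hT : MeasurePreserving T ν ν)
    (hS : MeasurePreserving S ν ν)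
    (hTS : ∀ A, MeasurableSet[MeasurableSpace.invariants T] A → S ⁻¹' A =ᵐ[ν] A)
    (hST : ∀ A, MeasurableSet[MeasurableSpace.invariants S] A → T ⁻¹' A =ᵐ[ν] A)
    {F : Ω → ℝ} (hF : Integrable F ν) :
    ν[F | MeasurableSpace.invariants T] =ᵐ[ν] ν[F | MeasurableSpace.invariants S] := by
  refine ae_eq_condExp_of_forall_setIntegral_eq (MeasurableSpace.invariants_le S) hF
    (fun _ _ _ => integrable_condExp.integrableOn) ?_ ?_
  · intro A hA _
    -- An `S`-invariant set is only almost `T`-invariant; it is replaced by a strictly `T`-invariant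
    -- set differing from it by a null set.
    obtain ⟨B, hB, hBA, hBT⟩ := hT.quasiMeasurePreserving.exists_preimage_eq_of_preimage_ae
      (MeasurableSpace.invariants_le S _ hA).nullMeasurableSet (hST A hA)
    rw [← setIntegral_congr_set hBA, ← setIntegral_congr_set hBA]
    exact setIntegral_condExp (MeasurableSpace.invariants_le T) hF ⟨hB, hBT⟩
  · exact aestronglyMeasurable_invariants_of_comp_ae_eq hS
      (stronglyMeasurable_condExp.mono (MeasurableSpace.invariants_le T)).aestronglyMeasurable
      (comp_ae_eq_of_forall_preimage_ae_eq hTS stronglyMeasurable_condExp.measurable)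

end MeanErgodic

end HostKra

namespace HostKra

/-! ### Fibres of a disintegration. -/

section Fibers

theorem exists_countable_isPiSystem (Ω : Type*) [mΩ : MeasurableSpace Ω]
    [MeasurableSpace.CountablyGenerated Ω] :
    ∃ 𝒜 : Set (Set Ω), 𝒜.Countable ∧ IsPiSystem 𝒜 ∧ mΩ = MeasurableSpace.generateFrom 𝒜 := by
  refine ⟨generateSetAlgebra (MeasurableSpace.countableGeneratingSet Ω),
    countable_generateSetAlgebra MeasurableSpace.countable_countableGeneratingSet, ?_, ?_⟩
  · exact fun s hs t ht _ => isSetAlgebra_generateSetAlgebra.inter_mem hs ht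
  · rw [generateFrom_generateSetAlgebra_eq, MeasurableSpace.generateFrom_countableGeneratingSet]

/-- A countable generating π-system lets one exceptional null set serve all measurable sets. -/
theorem ae_eq_of_forall_measurableSet {Ω Ω' : Type*} {mΩ' : MeasurableSpace Ω'}
    [mΩ : MeasurableSpace Ω] [MeasurableSpace.CountablyGenerated Ω] {P : Measure Ω'}
    {κ η : Ω' → Measure Ω} [∀ ω, IsFiniteMeasure (κ ω)]
    (h : ∀ B, MeasurableSet B → ∀ᵐ ω ∂P, κ ω B = η ω B) : κ =ᵐ[P] η := by
  obtain ⟨𝒜, hc, hpi, hgen⟩ := exists_countable_isPiSystem Ω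
  have hm : ∀ B ∈ 𝒜, MeasurableSet B := fun B hB =>
    hgen ▸ MeasurableSpace.measurableSet_generateFrom hB
  filter_upwards [(ae_ball_iff hc).2 fun B hB => h B (hm B hB), h _ .univ] with ω hω hu
  exact ext_of_generate_finite 𝒜 hgen hpi hω hu

variable {Ω : Type*} {m : MeasurableSpace Ω} [mΩ : MeasurableSpace Ω] [StandardBorelSpace Ω]
  {ν : Measure Ω} [IsProbabilityMeasure ν]

/-- Over any `A` in `m`, the indicators of `S ⁻¹' B` and `B` have the same integral, since `S`
preserves `ν` and moves `A` only by a null set. -/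
theorem ae_measurePreserving_condExpKernel (hm : m ≤ mΩ) {S : Ω → Ω}
    (hS : MeasurePreserving S ν ν) (h : ∀ A, MeasurableSet[m] A → S ⁻¹' A =ᵐ[ν] A) :
    ∀ᵐ ω ∂ν, MeasurePreserving S (condExpKernel ν m ω) (condExpKernel ν m ω) := by
  have : ∀ ω, IsFiniteMeasure ((condExpKernel ν m ω).map S) := fun ω => inferInstance
  have key : (fun ω => (condExpKernel ν m ω).map S) =ᵐ[ν] fun ω => condExpKernel ν m ω := by
    refine ae_eq_of_forall_measurableSet fun B hB => ?_
    have hSB : MeasurableSet (S ⁻¹' B) := hS.measurable hB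
    have hi : ∀ {D : Set Ω}, MeasurableSet D → Integrable (D.indicator fun _ => (1 : ℝ)) ν :=
      fun hD => (integrable_const 1).indicator hD
    have h1 : ν⟦S ⁻¹' B | m⟧ =ᵐ[ν] ν⟦B | m⟧ := by
      refine ae_eq_condExp_of_forall_setIntegral_eq hm (hi hB)
        (fun _ _ _ => integrable_condExp.integrableOn) (fun A hA _ => ?_)
        stronglyMeasurable_condExp.aestronglyMeasurable
      rw [setIntegral_condExp hm (hi hSB) hA, setIntegral_indicator hSB, setIntegral_indicator hB]
      simp only [integral_const, smul_eq_mul, mul_one, measureReal_restrict_apply .univ,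
        Set.univ_inter]
      have h2 : ν (A ∩ S ⁻¹' B) = ν (A ∩ B) := by
        rw [← hS.measure_preimage ((hm A hA).inter hB).nullMeasurableSet, Set.preimage_inter]
        exact measure_congr ((h A hA).symm.inter (ae_eq_refl _))
      rw [measureReal_def, measureReal_def, h2]
    filter_upwards [h1, condExpKernel_ae_eq_condExp hm hSB, condExpKernel_ae_eq_condExp hm hB]
      with ω a b c
    rw [Measure.map_apply hS.measurable hB, ← measureReal_eq_measureReal_iff, b, a, c]
  filter_upwards [key] with ω hω
  exact ⟨hS.measurable, hω⟩

theorem ae_ae_condExpKernel (hm : m ≤ mΩ) {p : Ω → Prop} (h : ∀ᵐ x ∂ν, p x) :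
    ∀ᵐ ω ∂ν, ∀ᵐ x ∂(condExpKernel ν m ω), p x := by
  rw [← condExpKernel_comp_trim hm (μ := ν)] at h
  exact ae_of_ae_trim hm (Measure.ae_ae_of_ae_comp h)

theorem ae_ae_condExpKernel_apply_eq (hm : m ≤ mΩ) {g : Ω → ℝ} (hg : Measurable[m] g) :
    ∀ᵐ ω ∂ν, ∀ᵐ x ∂(condExpKernel ν m ω), g x = g ω := by
  have hset : ∀ A, MeasurableSet[m] A →
      ∀ᵐ ω ∂ν, ∀ᵐ x ∂(condExpKernel ν m ω), x ∈ A ↔ ω ∈ A := by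
    intro A hA
    have h1 : ν⟦A | m⟧ = A.indicator fun _ => (1 : ℝ) :=
      condExp_of_stronglyMeasurable hm (stronglyMeasurable_const.indicator hA)
        ((integrable_const 1).indicator (hm A hA))
    filter_upwards [condExpKernel_ae_eq_condExp (μ := ν) hm (hm A hA)] with ω hω
    rw [h1] at hω
    by_cases hωA : ω ∈ A
    · have h2 : (condExpKernel ν m ω).real A = 1 := by simpa [hωA] using hω
      rw [measureReal_def, ENNReal.toReal_eq_one_iff] at h2
      have h3 : ∀ᵐ x ∂(condExpKernel ν m ω), x ∈ A :=
        (prob_compl_eq_zero_iff (hm A hA)).2 h2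
      filter_upwards [h3] with x hx
      simp [hx, hωA]
    · have h2 : (condExpKernel ν m ω).real A = 0 := by simpa [hωA] using hω
      rw [measureReal_eq_zero_iff] at h2
      filter_upwards [measure_eq_zero_iff_ae_notMem.1 h2] with x hx
      simp [hx, hωA]
  have h := ae_all_iff.2 fun q : ℚ => hset (g ⁻¹' Set.Iio (q : ℝ)) (hg measurableSet_Iio)
  filter_upwards [h] with ω hω
  filter_upwards [ae_all_iff.2 hω] with x hx
  exact eq_of_forall_lt_rat_iff_lt hx

/-- The kernel is `m`-measurable, and an `m`-measurable function is constant on almost every fibre.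
-/
theorem ae_ae_condExpKernel_eq (hm : m ≤ mΩ) :
    ∀ᵐ ω ∂ν, ∀ᵐ x ∂(condExpKernel ν m ω), condExpKernel ν m x = condExpKernel ν m ω := by
  obtain ⟨𝒜, hc, hpi, hgen⟩ := exists_countable_isPiSystem Ω
  have hmeas : ∀ B ∈ 𝒜, MeasurableSet B := fun B hB =>
    hgen ▸ MeasurableSpace.measurableSet_generateFrom hB
  have h1 : ∀ B ∈ 𝒜, ∀ᵐ ω ∂ν, ∀ᵐ x ∂(condExpKernel ν m ω),
      (condExpKernel ν m x).real B = (condExpKernel ν m ω).real B := fun B hB =>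
    ae_ae_condExpKernel_apply_eq hm (measurable_condExpKernel (hmeas B hB)).ennreal_toReal
  filter_upwards [(ae_ball_iff hc).2 h1] with ω hω
  filter_upwards [(ae_ball_iff hc).2 hω] with x hx
  exact ext_of_generate_finite 𝒜 hgen hpi
    (fun B hB => (measureReal_eq_measureReal_iff).1 (hx B hB)) (by simp)

end Fibers

/-! ### Ergodicity of the fibres over the invariant σ-algebra. -/

section FiberErgodic

variable {Ω : Type*} [mΩ : MeasurableSpace Ω]

/-- An invariant set independent of a generating π-system is independent of itself, so it has
measure 0 or 1. -/
theorem preErgodic_of_forall_measure_inter {ρ : Measure Ω} [IsProbabilityMeasure ρ] {T : Ω → Ω}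
    {𝒜 : Set (Set Ω)} (hpi : IsPiSystem 𝒜) (hgen : mΩ = MeasurableSpace.generateFrom 𝒜)
    (h : ∀ s, MeasurableSet s → T ⁻¹' s = s → ∀ B ∈ 𝒜, ρ (s ∩ B) = ρ s * ρ B) :
    PreErgodic T ρ := by
  refine ⟨fun s hs hTs => ?_⟩
  have h1 : ρ.restrict s = ρ s • ρ := by
    refine ext_of_generate_finite 𝒜 hgen hpi (fun B hB => ?_) (by simp)
    have hBm : MeasurableSet B := hgen ▸ MeasurableSpace.measurableSet_generateFrom hB
    rw [Measure.restrict_apply hBm, Set.inter_comm, h s hs hTs B hB]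
    simp
  have h2 : ρ s = ρ s * ρ s := by
    have := congrArg (fun μ => μ s) h1
    simpa [Measure.restrict_apply hs] using this
  rw [Filter.eventuallyConst_set']
  have h3 : ρ s = 0 ∨ ρ s = 1 := by
    by_cases h0 : ρ s = 0
    · exact Or.inl h0
    · right
      have := (ENNReal.mul_right_inj h0 (measure_ne_top ρ s)).1 (h2.symm.trans (mul_one _).symm)
      exact this
  rcases h3 with h3 | h3
  · exact Or.inl (ae_eq_empty.2 h3)
  · exact Or.inr (ae_eq_univ.2 ((prob_compl_eq_zero_iff hs).2 h3))

variable [StandardBorelSpace Ω] {ν : Measure Ω} [IsProbabilityMeasure ν] {T : Ω → Ω}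

omit [StandardBorelSpace Ω] in
theorem integral_indicator_mul_birkhoffAverage {ρ : Measure Ω} [IsProbabilityMeasure ρ]
    (hT : MeasurePreserving T ρ ρ) {s : Set Ω} (hs : MeasurableSet s) (hTs : T ⁻¹' s = s)
    {F : Ω → ℝ} (hF : Integrable F ρ) {N : ℕ} (hN : N ≠ 0) :
    ∫ x in s, birkhoffAverage ℝ T F N x ∂ρ = ∫ x in s, F x ∂ρ := by
  have h1 : ∀ n, ∫ x in s, F (T^[n] x) ∂ρ = ∫ x in s, F x ∂ρ := by
    intro n
    have hn : T^[n] ⁻¹' s = s := by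
      rw [Set.preimage_iterate_eq]
      exact Function.iterate_fixed hTs n
    have hTn := hT.iterate n
    rw [← integral_indicator hs, ← integral_indicator hs]
    have hae : AEStronglyMeasurable (s.indicator F) (ρ.map T^[n]) := by
      rw [hTn.map_eq]
      exact hF.aestronglyMeasurable.indicator hs
    have := integral_map hTn.measurable.aemeasurable hae
    rw [hTn.map_eq] at this
    rw [this]
    congr 1
    ext x
    have hx : x ∈ s ↔ T^[n] x ∈ s := by
      conv_lhs => rw [← hn]
      rfl
    by_cases hxs : x ∈ s
    · simp [hxs, hx.1 hxs]
    · simp [hxs, mt hx.2 hxs]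
  have h2 : ∀ x, birkhoffAverage ℝ T F N x
      = (N : ℝ)⁻¹ * ∑ n ∈ Finset.range N, F (T^[n] x) := fun x => rfl
  simp_rw [h2]
  rw [integral_const_mul, integral_finsetSum]
  · simp only [h1, Finset.sum_const, Finset.card_range, nsmul_eq_mul]
    field_simp
  · intro n _
    exact ((hT.iterate n).integrable_comp_of_integrable hF).integrableOn

/-- Almost every fibre of the disintegration of `ν` over the invariant σ-algebra of `T` is
ergodic. -/
theorem ae_ergodic_condExpKernel (hT : MeasurePreserving T ν ν) :
    ∀ᵐ ω ∂ν, Ergodic T (condExpKernel ν (MeasurableSpace.invariants T) ω) := by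
  have hm := MeasurableSpace.invariants_le T
  obtain ⟨𝒜, hc, hpi, hgen⟩ := exists_countable_isPiSystem Ω
  have hmeas : ∀ B ∈ 𝒜, MeasurableSet B := fun B hB =>
    hgen ▸ MeasurableSpace.measurableSet_generateFrom hB
  have hpres := ae_measurePreserving_condExpKernel hm hT fun A hA => ae_of_all _ fun x => by
    rw [hA.2]
  -- An almost everywhere convergent subsequence of the L² convergent averages does the work of the
  -- pointwise ergodic theorem. On a fibre the limit is constant, namely the fibre measure of `B`.
  have hconv : ∀ B ∈ 𝒜, ∃ ns : ℕ → ℕ, StrictMono ns ∧ ∀ᵐ ω ∂ν,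
      ∀ᵐ x ∂(condExpKernel ν (MeasurableSpace.invariants T) ω),
      Tendsto (fun k => birkhoffAverage ℝ T (B.indicator fun _ => (1 : ℝ)) (ns k) x) atTop
        (𝓝 ((condExpKernel ν (MeasurableSpace.invariants T) ω).real B)) := by
    intro B hB
    have hF : MemLp (B.indicator fun _ => (1 : ℝ)) 2 ν :=
      memLp_indicator_const 2 (hmeas B hB) 1 (Or.inr (measure_ne_top _ _))
    have h1 := tendsto_eLpNorm_birkhoffAverage_sub_condExp hT hF
    obtain ⟨ns, hns, hlim⟩ := (tendstoInMeasure_of_tendsto_eLpNorm two_ne_zero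
      (fun N => (memLp_birkhoffAverage hT hF N).aestronglyMeasurable)
      (hF.condExp one_le_two).aestronglyMeasurable h1).exists_seq_tendsto_ae
    refine ⟨ns, hns, ?_⟩
    have h2 := condExpKernel_ae_eq_condExp (μ := ν) hm (hmeas B hB)
    filter_upwards [ae_ae_condExpKernel hm hlim, ae_ae_condExpKernel hm h2,
      ae_ae_condExpKernel_eq (ν := ν) hm] with ω a b c
    filter_upwards [a, b, c] with x a b c
    rw [← c, b]
    exact a
  choose! ns hns hlim using hconv
  filter_upwards [hpres, (ae_ball_iff hc).2 hlim] with ω hω hl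
  refine ⟨hω, preErgodic_of_forall_measure_inter hpi hgen fun s hs hTs B hB => ?_⟩
  set ρ := condExpKernel ν (MeasurableSpace.invariants T) ω
  have hB' := hmeas B hB
  have hint : Integrable (B.indicator fun _ => (1 : ℝ)) ρ := (integrable_const 1).indicator hB'
  have hbd : ∀ x, |B.indicator (fun _ => (1 : ℝ)) x| ≤ 1 := fun x => by
    by_cases hx : x ∈ B <;> simp [hx]
  -- Over the invariant set `s`, averages of positive length integrate to the measure of `s ∩ B`,
  -- and their limit to the product of the measures: `s` is independent of `B`.
  have hdom : Tendsto (fun k => ∫ x in s, birkhoffAverage ℝ T (B.indicator fun _ => (1 : ℝ))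
      (ns B k) x ∂ρ) atTop (𝓝 (∫ _ in s, ρ.real B ∂ρ)) := by
    refine tendsto_integral_of_dominated_convergence (fun _ => 1) (fun k => ?_)
      (integrable_const 1) (fun k => ae_of_all _ fun x => abs_birkhoffAverage_le hbd _ _)
      (ae_restrict_of_ae (hl B hB))
    exact (measurable_birkhoffAverage hT.measurable
      (measurable_const.indicator hB') _).aestronglyMeasurable
  have hconst : ∀ᶠ k in atTop, ∫ x in s, birkhoffAverage ℝ T (B.indicator fun _ => (1 : ℝ))
      (ns B k) x ∂ρ = ∫ x in s, B.indicator (fun _ => (1 : ℝ)) x ∂ρ := by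
    filter_upwards [eventually_ge_atTop 1] with k hk
    refine integral_indicator_mul_birkhoffAverage hω hs hTs hint ?_
    have := (hns B hB).id_le k
    simp only [id] at this
    omega
  have heq := tendsto_nhds_unique hdom (tendsto_const_nhds.congr' (hconst.mono fun _ h => h.symm))
  rw [setIntegral_indicator hB'] at heq
  simp only [integral_const, smul_eq_mul, mul_one, measureReal_restrict_apply .univ,
    Set.univ_inter] at heq
  refine (ENNReal.toReal_eq_toReal_iff' (measure_ne_top _ _)
    (ENNReal.mul_ne_top (measure_ne_top _ _) (measure_ne_top _ _))).1 ?_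
  rw [ENNReal.toReal_mul]
  exact heq.symm

end FiberErgodic

end HostKra

namespace HostKra

/-! ### Invariance under a commuting map on the square of an ergodic system. -/

section CommutingInvariance

/-- L¹(σ) is separable: countably many ε-balls cover the sections `F x`, so one of them receives a
set of `x` that is not null. -/
theorem exists_measure_lintegral_sub_lt_ne_zero {Ω Y : Type*} [MeasurableSpace Ω]
    [MeasurableSpace Y] [MeasurableSpace.CountablyGenerated Y] {ρ : Measure Ω} [NeZero ρ]
    {σ : Measure Y} [IsFiniteMeasure σ] {F : Ω → Y → ℝ} (hF : Measurable (Function.uncurry F))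
    {C : ℝ} (hC : ∀ x y, |F x y| ≤ C) {ε : ℝ≥0∞} (hε : ε ≠ 0) :
    ∃ v : Y → ℝ, Measurable v ∧ ρ {x | ∫⁻ y, ‖F x y - v y‖ₑ ∂σ < ε} ≠ 0 := by
  have hFx : ∀ x, MemLp (F x) 1 σ := fun x =>
    MemLp.of_bound (hF.comp measurable_prodMk_left).aestronglyMeasurable C (ae_of_all _ (hC x))
  have : Fact ((1 : ℝ≥0∞) ≠ ⊤) := ⟨ENNReal.one_ne_top⟩
  by_contra! h
  have hcov : ∀ x, ∃ i, x ∈ {x | ∫⁻ y, ‖F x y - TopologicalSpace.denseSeq (Lp ℝ 1 σ) i y‖ₑ ∂σ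
      < ε} := by
    intro x
    have hd := TopologicalSpace.denseRange_denseSeq (Lp ℝ 1 σ)
    obtain ⟨_, ⟨i, rfl⟩, hi⟩ :=
      EMetric.mem_closure_iff.1 (hd (hFx x).toLp) ε (pos_iff_ne_zero.2 hε)
    refine ⟨i, ?_⟩
    rw [Lp.edist_def, eLpNorm_one_eq_lintegral_enorm] at hi
    refine lt_of_le_of_lt (le_of_eq (lintegral_congr_ae ?_)) hi
    filter_upwards [(hFx x).coeFn_toLp] with y hy
    simp [hy]
  have hU : (Set.univ : Set Ω) = ⋃ i, {x | ∫⁻ y,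
      ‖F x y - TopologicalSpace.denseSeq (Lp ℝ 1 σ) i y‖ₑ ∂σ < ε} := by
    ext x
    simpa using hcov x
  have h0 : ρ Set.univ = 0 := by
    rw [hU, measure_iUnion_null_iff]
    exact fun i => h _ (Lp.stronglyMeasurable _).measurable
  exact NeZero.ne ρ (Measure.measure_univ_eq_zero.1 h0)

variable {Ω : Type*} [mΩ : MeasurableSpace Ω] {ρ : Measure Ω} [IsProbabilityMeasure ρ]
  {T S : Ω → Ω}

theorem ae_exists_iterate_mem (hT : Ergodic T ρ) {B : Set Ω} (hB : MeasurableSet B)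
    (hB0 : ρ B ≠ 0) : ∀ᵐ x ∂ρ, ∃ n, T^[n] x ∈ B := by
  set E : Set Ω := ⋃ n, T^[n] ⁻¹' B
  have hE : MeasurableSet E := MeasurableSet.iUnion fun n => (hT.measurable.iterate n) hB
  have hTE : T ⁻¹' E ⊆ E := by
    intro x hx
    obtain ⟨n, hn⟩ := Set.mem_iUnion.1 hx
    exact Set.mem_iUnion.2 ⟨n + 1, hn⟩
  rcases hT.ae_empty_or_univ_of_preimage_ae_le hE.nullMeasurableSet hTE.eventuallyLE with h | h
  · refine absurd (measure_mono_null ?_ (ae_eq_empty.1 h)) hB0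
    exact Set.subset_iUnion (fun n => T^[n] ⁻¹' B) 0
  · filter_upwards [h.mem_iff] with x hx
    simpa [E] using hx

/-- The orbits of `x` and of `S x` both enter a set on which the sections of `F` lie within ε of
each other. The L¹ distance of sections is unchanged when both points move by `T`, so for each `(n,
k)` closeness holds on a `T`-invariant set; one of these countably many sets is not null, hence has
full measure. The point is that `n` and `k` do not depend on `x`. -/
theorem exists_ae_lintegral_iterate_sub_le {Y : Type*} [MeasurableSpace Y]
    [MeasurableSpace.CountablyGenerated Y] {σ : Measure Y} [IsFiniteMeasure σ] {T' : Y → Y}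
    (hT' : MeasurePreserving T' σ σ) (hT : Ergodic T ρ) (hS : MeasurePreserving S ρ ρ)
    (hST : Function.Commute S T) {F : Ω → Y → ℝ} (hF : Measurable (Function.uncurry F)) {C : ℝ}
    (hC : ∀ x y, |F x y| ≤ C) (hinv : ∀ x y, F (T x) (T' y) = F x y) {ε : ℝ≥0∞} (hε : ε ≠ 0) :
    ∃ n k : ℕ, ∀ᵐ x ∂ρ, ∫⁻ y, ‖F (T^[n] x) y - F (T^[k] (S x)) y‖ₑ ∂σ ≤ ε := by
  obtain ⟨v, hv, hv0⟩ := exists_measure_lintegral_sub_lt_ne_zero (ρ := ρ) (σ := σ) hF hC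
    (ENNReal.half_pos hε).ne'
  set B := {x | ∫⁻ y, ‖F x y - v y‖ₑ ∂σ < ε / 2}
  have hB : MeasurableSet B := by
    refine measurableSet_lt (Measurable.lintegral_prod_right' (f := fun p : Ω × Y =>
      ‖F p.1 p.2 - v p.2‖ₑ) ?_) measurable_const
    exact (hF.sub (hv.comp measurable_snd)).enorm
  have h1 := ae_exists_iterate_mem hT hB hv0
  have h2 := hS.quasiMeasurePreserving.ae h1
  set d : Ω → Ω → ℝ≥0∞ := fun x x' => ∫⁻ y, ‖F x y - F x' y‖ₑ ∂σ
  have hd : Measurable (Function.uncurry d) := by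
    refine Measurable.lintegral_prod_right' (f := fun p : (Ω × Ω) × Y =>
      ‖F p.1.1 p.2 - F p.1.2 p.2‖ₑ) ?_
    exact ((hF.comp (by fun_prop : Measurable fun p : (Ω × Ω) × Y => (p.1.1, p.2))).sub
      (hF.comp (by fun_prop : Measurable fun p : (Ω × Ω) × Y => (p.1.2, p.2)))).enorm
  have hdT : ∀ x x', d (T x) (T x') = d x x' := by
    intro x x'
    have hm : Measurable fun y => ‖F (T x) y - F (T x') y‖ₑ :=
      ((hF.comp measurable_prodMk_left).sub (hF.comp measurable_prodMk_left)).enorm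
    have := hT'.lintegral_comp hm
    simp only [hinv] at this
    exact this.symm
  have htri : ∀ x x', x ∈ B → x' ∈ B → d x x' ≤ ε := by
    intro x x' hx hx'
    calc d x x' ≤ ∫⁻ y, (‖F x y - v y‖ₑ + ‖F x' y - v y‖ₑ) ∂σ := by
          refine lintegral_mono fun y => ?_
          have : F x y - F x' y = (F x y - v y) - (F x' y - v y) := by ring
          rw [this]
          exact enorm_sub_le
      _ = ∫⁻ y, ‖F x y - v y‖ₑ ∂σ + ∫⁻ y, ‖F x' y - v y‖ₑ ∂σ :=
          lintegral_add_left ((hF.comp measurable_prodMk_left).sub hv).enorm _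
      _ ≤ ε / 2 + ε / 2 := add_le_add (le_of_lt hx) (le_of_lt hx')
      _ = ε := ENNReal.add_halves ε
  set E : ℕ × ℕ → Set Ω := fun p => {x | d (T^[p.1] x) (T^[p.2] (S x)) ≤ ε}
  have hEm : ∀ p, MeasurableSet (E p) := fun p => by
    refine measurableSet_le (hd.comp (Measurable.prodMk (hT.measurable.iterate _) ?_))
      measurable_const
    exact (hT.measurable.iterate _).comp hS.measurable
  have hEinv : ∀ p, T ⁻¹' (E p) = E p := fun p => by
    ext x
    have e1 : T^[p.1] (T x) = T (T^[p.1] x) := (Function.Commute.iterate_self T p.1) x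
    have e2 : T^[p.2] (S (T x)) = T (T^[p.2] (S x)) := by
      rw [hST x]
      exact (Function.Commute.iterate_self T p.2) _
    simp only [E, Set.mem_preimage, Set.mem_ofPred_eq, e1, e2, hdT]
  have hcov : ∀ᵐ x ∂ρ, x ∈ ⋃ p, E p := by
    filter_upwards [h1, h2] with x ⟨n, hn⟩ ⟨k, hk⟩
    exact Set.mem_iUnion.2 ⟨(n, k), htri _ _ hn hk⟩
  have hex : ∃ p, ρ (E p) ≠ 0 := by
    by_contra! h
    have h0 : ρ (⋃ p, E p) = 0 := measure_iUnion_null_iff.2 h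
    have h1 : ∀ᵐ x ∂ρ, False := by
      filter_upwards [hcov, measure_eq_zero_iff_ae_notMem.1 h0] with x a b using b a
    exact IsProbabilityMeasure.ne_zero ρ (ae_eq_bot.1 (eventually_false_iff_eq_bot.1 h1))
  obtain ⟨⟨n, k⟩, hp⟩ := hex
  refine ⟨n, k, ?_⟩
  rcases hT.toPreErgodic.ae_empty_or_univ (hEm (n, k)) (hEinv (n, k)) with h | h
  · exact absurd (ae_eq_empty.1 h) hp
  · filter_upwards [h.mem_iff] with x hx
    exact hx.2 trivial

/-- If `T` is ergodic and `S` commutes with `T`, then a `T × T`-invariant function is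
`S × S`-invariant. -/
theorem ae_prod_comp_eq_of_ergodic_of_commute [MeasurableSpace.CountablyGenerated Ω]
    (hT : Ergodic T ρ) (hS : MeasurePreserving S ρ ρ) (hST : Function.Commute S T)
    {F : Ω × Ω → ℝ} (hF : Measurable F) {C : ℝ} (hC : ∀ p, |F p| ≤ C)
    (hinv : ∀ x y, F (T x, T y) = F (x, y)) :
    ∀ᵐ p ∂(ρ.prod ρ), F (S p.1, S p.2) = F p := by
  -- The sections `F (x, ·)` and `F (·, x)` are bundled together so that one pair `n`, `k` serves
  -- both coordinates.
  set G : Ω → Bool × Ω → ℝ := fun x q => bif q.1 then F (x, q.2) else F (q.2, x)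
  have hG : Measurable (Function.uncurry G) := by
    have : Function.uncurry G = fun q : Ω × Bool × Ω =>
        if q.2.1 = true then F (q.1, q.2.2) else F (q.2.2, q.1) := by
      funext ⟨x, b, y⟩
      cases b <;> rfl
    rw [this]
    refine Measurable.ite ?_ (hF.comp (by fun_prop)) (hF.comp (by fun_prop))
    exact (measurable_fst.comp measurable_snd) (measurableSet_singleton true)
  have hGC : ∀ x q, |G x q| ≤ C := by
    rintro x ⟨b, y⟩
    cases b
    · exact hC _
    · exact hC _
  have hT' : MeasurePreserving (Prod.map (_root_.id : Bool → Bool) T)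
      ((Measure.count : Measure Bool).prod ρ) ((Measure.count : Measure Bool).prod ρ) :=
    (MeasurePreserving.id _).prod hT.toMeasurePreserving
  have hGinv : ∀ x q, G (T x) (Prod.map (_root_.id : Bool → Bool) T q) = G x q := by
    rintro x ⟨b, y⟩
    cases b
    · exact hinv _ _
    · exact hinv _ _
  have hkey : ∀ ε : ℝ≥0∞, ε ≠ 0 →
      ∫⁻ p, ‖F (S p.1, S p.2) - F p‖ₑ ∂(ρ.prod ρ) ≤ ε + ε := by
    intro ε hε
    obtain ⟨n, k, hnk⟩ := exists_ae_lintegral_iterate_sub_le hT' hT hS hST hG hGC hGinv hε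
    have hsplit : ∀ x x', ∫⁻ q, ‖G x q - G x' q‖ₑ ∂((Measure.count : Measure Bool).prod ρ)
        = ∫⁻ y, ‖F (y, x) - F (y, x')‖ₑ ∂ρ + ∫⁻ y, ‖F (x, y) - F (x', y)‖ₑ ∂ρ := by
      intro x x'
      rw [lintegral_prod]
      · rw [lintegral_count, tsum_bool]
        rfl
      · exact ((hG.comp measurable_prodMk_left).sub
          (hG.comp measurable_prodMk_left)).enorm.aemeasurable
    simp_rw [hsplit] at hnk
    set W : Ω → Ω := fun x => T^[k] (S x)
    have hW : MeasurePreserving W ρ ρ := (hT.toMeasurePreserving.iterate k).comp hS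
    have hV : MeasurePreserving T^[n] ρ ρ := hT.toMeasurePreserving.iterate n
    have hit : ∀ j x y, F (T^[j] x, T^[j] y) = F (x, y) := by
      intro j
      induction j with
      | zero => exact fun x y => rfl
      | succ j ih =>
        intro x y
        rw [Function.iterate_succ_apply', Function.iterate_succ_apply', hinv, ih]
    -- By invariance the two terms are the values of `F` at `(W p.1, W p.2)` and at `(T^[n] p.1,
    -- T^[n] p.2)`; the coordinates are then exchanged one at a time, each at cost ε.
    have hWV : ∀ p : Ω × Ω, F (S p.1, S p.2) - F p
        = (F (W p.1, W p.2) - F (T^[n] p.1, W p.2))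
          + (F (T^[n] p.1, W p.2) - F (T^[n] p.1, T^[n] p.2)) := by
      intro p
      rw [hit n p.1 p.2, hit k]
      ring
    have hmW := hW.measurable
    have hmV := hV.measurable
    calc ∫⁻ p, ‖F (S p.1, S p.2) - F p‖ₑ ∂(ρ.prod ρ)
        ≤ ∫⁻ p, (‖F (W p.1, W p.2) - F (T^[n] p.1, W p.2)‖ₑ
          + ‖F (T^[n] p.1, W p.2) - F (T^[n] p.1, T^[n] p.2)‖ₑ) ∂(ρ.prod ρ) := by
          refine lintegral_mono fun p => ?_
          rw [hWV p]
          exact enorm_add_le _ _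
      _ = ∫⁻ p, ‖F (W p.1, W p.2) - F (T^[n] p.1, W p.2)‖ₑ ∂(ρ.prod ρ)
          + ∫⁻ p, ‖F (T^[n] p.1, W p.2) - F (T^[n] p.1, T^[n] p.2)‖ₑ ∂(ρ.prod ρ) := by
          refine lintegral_add_left ?_ _
          fun_prop
      _ ≤ ε + ε := by
          refine add_le_add ?_ ?_
          · rw [lintegral_prod _ (by fun_prop)]
            have : ∀ x, ∫⁻ y, ‖F (W x, W y) - F (T^[n] x, W y)‖ₑ ∂ρ
                = ∫⁻ y, ‖F (T^[n] x, y) - F (W x, y)‖ₑ ∂ρ := by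
              intro x
              rw [← hW.lintegral_comp (f := fun y => ‖F (T^[n] x, y) - F (W x, y)‖ₑ)
                (by fun_prop)]
              exact lintegral_congr fun y => enorm_sub_rev _ _
            simp_rw [this]
            refine (lintegral_mono_ae (g := fun _ => ε) ?_).trans (by simp)
            filter_upwards [hnk] with x hx
            exact le_add_self.trans hx
          · rw [lintegral_prod_symm _ (by fun_prop)]
            have : ∀ y, ∫⁻ x, ‖F (T^[n] x, W y) - F (T^[n] x, T^[n] y)‖ₑ ∂ρ
                = ∫⁻ x, ‖F (x, T^[n] y) - F (x, W y)‖ₑ ∂ρ := by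
              intro y
              rw [← hV.lintegral_comp (f := fun x => ‖F (x, T^[n] y) - F (x, W y)‖ₑ)
                (by fun_prop)]
              exact lintegral_congr fun x => enorm_sub_rev _ _
            simp_rw [this]
            refine (lintegral_mono_ae (g := fun _ => ε) ?_).trans (by simp)
            filter_upwards [hnk] with y hy
            exact le_self_add.trans hy
  have hSm := hS.measurable
  have hzero : ∫⁻ p, ‖F (S p.1, S p.2) - F p‖ₑ ∂(ρ.prod ρ) = 0 := by
    by_contra h
    -- With ε a quarter of the integral, the bound `ε + ε` would be half of it.
    have h4 : (∫⁻ p, ‖F (S p.1, S p.2) - F p‖ₑ ∂(ρ.prod ρ)) / 2 ≠ 0 :=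
      (ENNReal.half_pos h).ne'
    have hfin : ∫⁻ p, ‖F (S p.1, S p.2) - F p‖ₑ ∂(ρ.prod ρ) ≠ ⊤ :=
      ne_top_of_le_ne_top (by simp) (hkey 1 one_ne_zero)
    have := hkey _ (ENNReal.half_pos h4).ne'
    rw [ENNReal.add_halves] at this
    exact absurd this (not_le.2 (ENNReal.half_lt_self h hfin))
  rw [lintegral_eq_zero_iff (by fun_prop)] at hzero
  filter_upwards [hzero] with p hp
  simpa [sub_eq_zero] using hp

end CommutingInvariance

end HostKra

namespace HostKra

theorem integral_comp_of_measurePreserving {α β : Type*} [MeasurableSpace α] [MeasurableSpace β]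
    {μ : Measure α} {ν : Measure β} {φ : α → β} (hφ : MeasurePreserving φ μ ν) {g : β → ℝ}
    (hg : AEStronglyMeasurable g ν) : ∫ x, g (φ x) ∂μ = ∫ y, g y ∂ν := by
  rw [← hφ.map_eq] at hg ⊢
  exact (integral_map hφ.measurable.aemeasurable hg).symm

/-! ### Symmetries of the relatively independent square. -/

section RelIndepSquare

variable {Ω : Type*} {m : MeasurableSpace Ω} [mΩ : MeasurableSpace Ω] [StandardBorelSpace Ω]
  {ν : Measure Ω} [IsProbabilityMeasure ν]

theorem ae_relIndepSquare_of_ae_ae (hm : m ≤ mΩ) {p : Ω × Ω → Prop}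
    (hp : MeasurableSet {x | p x})
    (h : ∀ᵐ ω ∂ν, ∀ᵐ x ∂((condExpKernel ν m ω).prod (condExpKernel ν m ω)), p x) :
    ∀ᵐ x ∂(relIndepSquare m ν), p x := by
  have hp' : MeasurableSet {x | ¬ p x} := hp.compl
  rw [ae_iff, relIndepSquare, Measure.bind_apply hp'
    (measurable_condExpKernel_prod ν hm).aemeasurable]
  exact (lintegral_congr_ae h).trans lintegral_zero

theorem measureReal_relIndepSquare_prod (hm : m ≤ mΩ) {A B : Set Ω} (hA : MeasurableSet A)
    (hB : MeasurableSet B) :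
    (relIndepSquare m ν).real (A ×ˢ B) = ∫ ω, (ν⟦A | m⟧) ω * (ν⟦B | m⟧) ω ∂ν := by
  have hbd : ∀ (D : Set Ω) ω, ‖D.indicator (fun _ => (1 : ℝ)) ω‖ ≤ 1 := fun D ω => by
    by_cases h : ω ∈ D <;> simp [h]
  rw [← integral_relIndepSquare ν hm (measurable_const.indicator hA)
    (measurable_const.indicator hB) (hbd A) (hbd B), ← integral_indicator_one (hA.prod hB)]
  congr 1
  ext p
  by_cases h1 : p.1 ∈ A <;> by_cases h2 : p.2 ∈ B <;> simp [h1, h2, Set.indicator]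

theorem ext_relIndepSquare (hm : m ≤ mΩ) {ρ : Measure (Ω × Ω)} [IsFiniteMeasure ρ]
    (h : ∀ A B : Set Ω, MeasurableSet A → MeasurableSet B →
      ρ.real (A ×ˢ B) = ∫ ω, (ν⟦A | m⟧) ω * (ν⟦B | m⟧) ω ∂ν) :
    ρ = relIndepSquare m ν := by
  have := isProbabilityMeasure_relIndepSquare ν hm
  refine Measure.ext_prod fun {A B} hA hB => ?_
  rw [← measureReal_eq_measureReal_iff, h A B hA hB, measureReal_relIndepSquare_prod hm hA hB]

theorem measurePreserving_fst_relIndepSquare (hm : m ≤ mΩ) :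
    MeasurePreserving Prod.fst (relIndepSquare m ν) ν := by
  have := isProbabilityMeasure_relIndepSquare ν hm
  refine ⟨measurable_fst, Measure.ext fun A hA => ?_⟩
  rw [Measure.map_apply measurable_fst hA, ← measureReal_eq_measureReal_iff,
    ← Set.prod_univ, measureReal_relIndepSquare_prod hm hA .univ]
  have h1 : ν⟦Set.univ | m⟧ = fun _ => (1 : ℝ) := by
    rw [Set.indicator_univ]
    exact condExp_const hm 1
  simp only [h1, mul_one]
  rw [integral_condExp hm, integral_indicator_const _ hA, smul_eq_mul, mul_one]

theorem measurePreserving_prodMap_relIndepSquare {T R : Ω → Ω} (hT : MeasurePreserving T ν ν)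
    (hR : MeasurePreserving R ν ν) (hRT : Function.Commute R T) :
    MeasurePreserving (Prod.map R R) (relIndepSquare (MeasurableSpace.invariants T) ν)
      (relIndepSquare (MeasurableSpace.invariants T) ν) := by
  have hm := MeasurableSpace.invariants_le T
  have := isProbabilityMeasure_relIndepSquare ν hm
  have hmeas : Measurable (Prod.map R R) := hR.measurable.prodMap hR.measurable
  refine ⟨hmeas, ext_relIndepSquare hm fun A B hA hB => ?_⟩
  rw [map_measureReal_apply hmeas (hA.prod hB)]
  have hpre : Prod.map R R ⁻¹' (A ×ˢ B) = (R ⁻¹' A) ×ˢ (R ⁻¹' B) := rfl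
  rw [hpre, measureReal_relIndepSquare_prod hm (hR.measurable hA) (hR.measurable hB)]
  have hc : ∀ D, MeasurableSet D → ν⟦R ⁻¹' D | MeasurableSpace.invariants T⟧
      =ᵐ[ν] ν⟦D | MeasurableSpace.invariants T⟧ ∘ R := fun D hD =>
    condExp_invariants_comp_of_commute hT hR hRT
      (memLp_indicator_const 2 hD (1 : ℝ) (Or.inr (measure_ne_top _ _)))
  refine Eq.trans ?_ (integral_comp_of_measurePreserving hR
    (g := fun ω => (ν⟦A | MeasurableSpace.invariants T⟧) ω
      * (ν⟦B | MeasurableSpace.invariants T⟧) ω)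
    (integrable_condExp.aestronglyMeasurable.mul integrable_condExp.aestronglyMeasurable))
  refine integral_congr_ae ?_
  filter_upwards [hc A hA, hc B hB] with ω h1 h2
  rw [h1, h2]
  rfl

/-- Only conditional expectations on the invariant sets enter the measure, and these do not change
when one factor is composed with `T`. -/
theorem measurePreserving_id_prodMap_relIndepSquare {T : Ω → Ω}
    (hT : MeasurePreserving T ν ν) :
    MeasurePreserving (Prod.map _root_.id T) (relIndepSquare (MeasurableSpace.invariants T) ν)
      (relIndepSquare (MeasurableSpace.invariants T) ν) := by
  have hm := MeasurableSpace.invariants_le T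
  have := isProbabilityMeasure_relIndepSquare ν hm
  have hmeas : Measurable (Prod.map (_root_.id : Ω → Ω) T) := measurable_id.prodMap hT.measurable
  refine ⟨hmeas, ext_relIndepSquare hm fun A B hA hB => ?_⟩
  rw [map_measureReal_apply hmeas (hA.prod hB)]
  have hpre : Prod.map _root_.id T ⁻¹' (A ×ˢ B) = A ×ˢ (T ⁻¹' B) := rfl
  rw [hpre, measureReal_relIndepSquare_prod hm hA (hT.measurable hB)]
  have hc := condExp_invariants_comp_self hT
      (memLp_indicator_const 2 hB (1 : ℝ) (Or.inr (measure_ne_top ν B)))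
  refine integral_congr_ae ?_
  filter_upwards [hc] with ω h1
  congr 1

theorem relIndepSquare_invariants_congr {T S : Ω → Ω} (hT : MeasurePreserving T ν ν)
    (hS : MeasurePreserving S ν ν)
    (hTS : ∀ A, MeasurableSet[MeasurableSpace.invariants T] A → S ⁻¹' A =ᵐ[ν] A)
    (hST : ∀ A, MeasurableSet[MeasurableSpace.invariants S] A → T ⁻¹' A =ᵐ[ν] A) :
    relIndepSquare (MeasurableSpace.invariants T) ν
      = relIndepSquare (MeasurableSpace.invariants S) ν := by
  have hm := MeasurableSpace.invariants_le T
  have := isProbabilityMeasure_relIndepSquare ν hm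
  refine ext_relIndepSquare (MeasurableSpace.invariants_le S) fun A B hA hB => ?_
  rw [measureReal_relIndepSquare_prod hm hA hB]
  have hc : ∀ D, MeasurableSet D → ν⟦D | MeasurableSpace.invariants T⟧
      =ᵐ[ν] ν⟦D | MeasurableSpace.invariants S⟧ := fun D hD =>
    condExp_invariants_congr hT hS hTS hST ((integrable_const 1).indicator hD)
  refine integral_congr_ae ?_
  filter_upwards [hc A hA, hc B hB] with ω h1 h2
  rw [h1, h2]

/-- In almost every fibre `T` is ergodic, and `S` preserves the fibre measure because it fixes
invariant sets up to null sets. The result on products of ergodic systems then applies fibre by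
fibre. -/
theorem preimage_prodMap_ae_eq_relIndepSquare {T S : Ω → Ω} (hT : MeasurePreserving T ν ν)
    (hS : MeasurePreserving S ν ν) (hST : Function.Commute S T)
    (h : ∀ A, MeasurableSet[MeasurableSpace.invariants T] A → S ⁻¹' A =ᵐ[ν] A)
    {D : Set (Ω × Ω)} (hD : MeasurableSet D) (hDT : Prod.map T T ⁻¹' D = D) :
    Prod.map S S ⁻¹' D =ᵐ[relIndepSquare (MeasurableSpace.invariants T) ν] D := by
  have hm := MeasurableSpace.invariants_le T
  set F : Ω × Ω → ℝ := D.indicator fun _ => 1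
  have hF : Measurable F := measurable_const.indicator hD
  have hC : ∀ p, |F p| ≤ 1 := fun p => by by_cases hp : p ∈ D <;> simp [F, hp]
  have hinv : ∀ x y, F (T x, T y) = F (x, y) := by
    intro x y
    have hiff : (T x, T y) ∈ D ↔ (x, y) ∈ D := by
      conv_rhs => rw [← hDT]
      rfl
    by_cases hxy : (x, y) ∈ D
    · simp [F, hxy, hiff.2 hxy]
    · simp [F, hxy, mt hiff.1 hxy]
  have hae : ∀ᵐ p ∂(relIndepSquare (MeasurableSpace.invariants T) ν),
      F (S p.1, S p.2) = F p := by
    have hSm := hS.measurable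
    refine ae_relIndepSquare_of_ae_ae hm (measurableSet_eq_fun (by fun_prop) hF) ?_
    filter_upwards [ae_ergodic_condExpKernel hT, ae_measurePreserving_condExpKernel hm hS h]
      with ω h1 h2
    exact ae_prod_comp_eq_of_ergodic_of_commute h1 h2 hST hF hC hinv
  filter_upwards [hae] with p hp
  have e1 : p ∈ D ↔ F p = 1 := by by_cases hp : p ∈ D <;> simp [F, hp]
  have e2 : p ∈ Prod.map S S ⁻¹' D ↔ F (S p.1, S p.2) = 1 := by
    have : p ∈ Prod.map S S ⁻¹' D ↔ (S p.1, S p.2) ∈ D := Iff.rfl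
    rw [this]
    by_cases hp : (S p.1, S p.2) ∈ D <;> simp [F, hp]
  exact propext (e2.trans (hp ▸ e1.symm))

end RelIndepSquare

end HostKra

namespace HostKra

/-! ### Cube measures of commuting transformations. -/

section CubeMeasure

variable {X : Type*} [MeasurableSpace X] [StandardBorelSpace X] {μ : Measure X}
  [IsProbabilityMeasure μ] {T S : X → X}

instance (T : X → X) (μ : Measure X) [IsProbabilityMeasure μ] (k : ℕ) :
    IsProbabilityMeasure (cubeMeasure T μ k) :=
  (cubeProb T μ k).2

theorem cubeMeasure_zero (T : X → X) (μ : Measure X) [IsProbabilityMeasure μ] :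
    cubeMeasure T μ 0 = μ.map fun x _ => x :=
  rfl

theorem cubeMeasure_succ (T : X → X) (μ : Measure X) [IsProbabilityMeasure μ] (k : ℕ) :
    cubeMeasure T μ (k + 1) = (relIndepSquare (MeasurableSpace.invariants (cubeMap T k))
      (cubeMeasure T μ k)).map (cubeGlue k) :=
  rfl

omit [StandardBorelSpace X] in
theorem measurable_cubeMap (hT : Measurable T) (k : ℕ) : Measurable (cubeMap T k) :=
  measurable_pi_lambda _ fun ε => hT.comp (measurable_pi_apply ε)

omit [MeasurableSpace X] [StandardBorelSpace X] in
theorem cubeMap_commute (h : Function.Commute S T) (k : ℕ) :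
    Function.Commute (cubeMap S k) (cubeMap T k) :=
  fun x => funext fun ε => h (x ε)

omit [MeasurableSpace X] [StandardBorelSpace X] in
theorem cubeMap_cubeGlue (T : X → X) (k : ℕ) (p : Cube X k × Cube X k) :
    cubeMap T (k + 1) (cubeGlue k p) = cubeGlue k (Prod.map (cubeMap T k) (cubeMap T k) p) := by
  funext ε
  cases h : ε (Fin.last k) <;> simp [cubeMap, cubeGlue, h]

theorem measurePreserving_diag (T : X → X) (μ : Measure X) [IsProbabilityMeasure μ] :
    MeasurePreserving (fun (x : X) (_ : Fin 0 → Bool) => x) μ (cubeMeasure T μ 0) :=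
  ⟨measurable_pi_lambda _ fun _ => measurable_id, rfl⟩

theorem measurePreserving_cubeGlue (T : X → X) (μ : Measure X) [IsProbabilityMeasure μ] (k : ℕ) :
    MeasurePreserving (cubeGlue k)
      (relIndepSquare (MeasurableSpace.invariants (cubeMap T k)) (cubeMeasure T μ k))
      (cubeMeasure T μ (k + 1)) :=
  ⟨measurable_cubeGlue k, rfl⟩

theorem measurePreserving_of_semiconj {α β : Type*} [MeasurableSpace α] [MeasurableSpace β]
    {ρ : Measure α} {σ : Measure β} {π : α → β} (hπ : MeasurePreserving π ρ σ) {f : α → α}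
    {g : β → β} (hf : MeasurePreserving f ρ ρ) (hg : Measurable g)
    (h : ∀ x, g (π x) = π (f x)) : MeasurePreserving g σ σ := by
  refine ⟨hg, ?_⟩
  rw [← hπ.map_eq, Measure.map_map hg hπ.measurable]
  have : g ∘ π = π ∘ f := funext h
  rw [this, ← Measure.map_map hπ.measurable hf.measurable, hf.map_eq]

/-- Maps commuting with `T` act on the cube measures of `T`. -/
theorem measurePreserving_cubeMap (hT : MeasurePreserving T μ μ) (hS : MeasurePreserving S μ μ)
    (hST : Function.Commute S T) (k : ℕ) :
    MeasurePreserving (cubeMap S k) (cubeMeasure T μ k) (cubeMeasure T μ k) ∧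
      MeasurePreserving (cubeMap T k) (cubeMeasure T μ k) (cubeMeasure T μ k) := by
  induction k with
  | zero =>
    exact ⟨measurePreserving_of_semiconj (measurePreserving_diag T μ) hS
        (measurable_cubeMap hS.measurable 0) fun _ => rfl,
      measurePreserving_of_semiconj (measurePreserving_diag T μ) hT
        (measurable_cubeMap hT.measurable 0) fun _ => rfl⟩
  | succ k ih =>
    exact ⟨measurePreserving_of_semiconj (measurePreserving_cubeGlue T μ k)
        (measurePreserving_prodMap_relIndepSquare ih.2 ih.1 (cubeMap_commute hST k))
        (measurable_cubeMap hS.measurable _) (cubeMap_cubeGlue S k),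
      measurePreserving_of_semiconj (measurePreserving_cubeGlue T μ k)
        (measurePreserving_prodMap_relIndepSquare ih.2 ih.2 (Function.Commute.refl _))
        (measurable_cubeMap hT.measurable _) (cubeMap_cubeGlue T k)⟩

theorem measurePreserving_cubeMap_self (hT : MeasurePreserving T μ μ) (k : ℕ) :
    MeasurePreserving (cubeMap T k) (cubeMeasure T μ k) (cubeMeasure T μ k) :=
  (measurePreserving_cubeMap hT hT (Function.Commute.refl T) k).1

theorem preimage_ae_eq_of_semiconj {α β : Type*} [MeasurableSpace α] [MeasurableSpace β]
    {ρ : Measure α} {σ : Measure β} {π : α → β} (hπ : MeasurePreserving π ρ σ) {f : α → α}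
    {g : β → β} (hg : Measurable g) (h : ∀ x, g (π x) = π (f x)) {A : Set β}
    (hA : MeasurableSet A) (hfA : f ⁻¹' (π ⁻¹' A) =ᵐ[ρ] π ⁻¹' A) : g ⁻¹' A =ᵐ[σ] A := by
  have hmeas : MeasurableSet {y | y ∈ g ⁻¹' A ↔ y ∈ A} :=
    measurableSet_setOfPred.2 ((measurableSet_setOfPred.1 (hg hA)).iff (measurableSet_setOfPred.1 hA))
  have hae : ∀ᵐ y ∂σ, y ∈ g ⁻¹' A ↔ y ∈ A := by
    rw [← hπ.map_eq, ae_map_iff hπ.measurable.aemeasurable hmeas]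
    filter_upwards [hfA.mem_iff] with x hx
    rw [Set.mem_preimage, h]
    exact hx
  filter_upwards [hae] with y hy
  exact propext hy

/-- Commuting ergodic transformations have the same cube measures and, up to null sets, the same
invariant sets on the cube spaces. -/
theorem cubeMeasure_eq_and_invariants (hT : Ergodic T μ) (hS : Ergodic S μ)
    (hST : Function.Commute S T) (k : ℕ) :
    cubeMeasure T μ k = cubeMeasure S μ k ∧
      (∀ A, MeasurableSet[MeasurableSpace.invariants (cubeMap T k)] A →
        cubeMap S k ⁻¹' A =ᵐ[cubeMeasure T μ k] A) ∧
      (∀ A, MeasurableSet[MeasurableSpace.invariants (cubeMap S k)] A →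
        cubeMap T k ⁻¹' A =ᵐ[cubeMeasure T μ k] A) := by
  induction k with
  | zero =>
    -- In dimension 0 ergodicity makes every invariant set null or conull, so commutation plays no
    -- role yet.
    have key : ∀ {T S : X → X}, Ergodic T μ → Ergodic S μ → ∀ A : Set (Cube X 0),
        MeasurableSet[MeasurableSpace.invariants (cubeMap T 0)] A →
        cubeMap S 0 ⁻¹' A =ᵐ[cubeMeasure T μ 0] A := by
      intro T S hT hS A hA
      have hd := measurePreserving_diag T μ
      refine preimage_ae_eq_of_semiconj hd (measurable_cubeMap hS.measurable 0)
        (f := S) (fun _ => rfl) hA.1 ?_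
      have h1 : T ⁻¹' ((fun (x : X) (_ : Fin 0 → Bool) => x) ⁻¹' A)
          = (fun (x : X) (_ : Fin 0 → Bool) => x) ⁻¹' A := by
        conv_rhs => rw [← hA.2]
        rfl
      rcases hT.toPreErgodic.ae_empty_or_univ (hd.measurable hA.1) h1 with h | h
      · exact (hS.quasiMeasurePreserving.preimage_ae_eq h).trans h.symm
      · exact (hS.quasiMeasurePreserving.preimage_ae_eq h).trans h.symm
    exact ⟨rfl, key hT hS, key hS hT⟩
  | succ k ih =>
    obtain ⟨heq, h1, h2⟩ := ih
    have hmT := measurePreserving_cubeMap hT.toMeasurePreserving hS.toMeasurePreserving hST k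
    -- Invariant sets agreeing up to null sets in dimension `k` give equal squares; this is why the
    -- induction carries the sets along with the measures.
    have hrel := relIndepSquare_invariants_congr hmT.2 hmT.1 h1 h2
    have hglue := measurePreserving_cubeGlue T μ k
    refine ⟨?_, fun A hA => ?_, fun A hA => ?_⟩
    · rw [cubeMeasure_succ, cubeMeasure_succ, hrel]
      congr 1
      simp only [heq]
    · refine preimage_ae_eq_of_semiconj hglue (measurable_cubeMap hS.measurable _)
        (cubeMap_cubeGlue S k) hA.1 ?_
      refine preimage_prodMap_ae_eq_relIndepSquare hmT.2 hmT.1 (cubeMap_commute hST k) h1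
        (hglue.measurable hA.1) ?_
      ext p
      rw [Set.mem_preimage, Set.mem_preimage, ← cubeMap_cubeGlue, Set.mem_preimage]
      exact (Set.ext_iff.1 hA.2) _
    · refine preimage_ae_eq_of_semiconj hglue (measurable_cubeMap hT.measurable _)
        (cubeMap_cubeGlue T k) hA.1 ?_
      rw [hrel]
      refine preimage_prodMap_ae_eq_relIndepSquare hmT.1 hmT.2 (cubeMap_commute hST.symm k) h2
        (hglue.measurable hA.1) ?_
      ext p
      rw [Set.mem_preimage, Set.mem_preimage, ← cubeMap_cubeGlue, Set.mem_preimage]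
      exact (Set.ext_iff.1 hA.2) _

theorem seminorm_eq_of_commute (hT : Ergodic T μ) (hS : Ergodic S μ)
    (hST : Function.Commute S T) (k : ℕ) (f : X → ℝ) : seminorm T μ k f = seminorm S μ k f := by
  rw [seminorm, seminorm, (cubeMeasure_eq_and_invariants hT hS hST k).1]

end CubeMeasure

end HostKra

namespace HostKra

/-! ### Elementary L² inequalities. -/

section L2

variable {Ω : Type*} [mΩ : MeasurableSpace Ω] {ν : Measure Ω} [IsProbabilityMeasure ν]

theorem sq_integral_le_integral_sq {f : Ω → ℝ} (hf : MemLp f 2 ν) :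
    (∫ x, f x ∂ν) ^ 2 ≤ ∫ x, f x ^ 2 ∂ν := by
  have h := ProbabilityTheory.variance_nonneg f ν
  rw [ProbabilityTheory.variance_eq_sub hf] at h
  simpa using h

theorem sq_integral_mul_le {f g : Ω → ℝ} (hf : MemLp f 2 ν) (hg : AEStronglyMeasurable g ν)
    {C : ℝ} (hC : ∀ᵐ x ∂ν, |g x| ≤ C) :
    (∫ x, f x * g x ∂ν) ^ 2 ≤ C ^ 2 * ∫ x, f x ^ 2 ∂ν := by
  have hfg : MemLp (fun x => f x * g x) 2 ν := by
    refine MemLp.of_le_mul (c := C) hf (hf.aestronglyMeasurable.mul hg) ?_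
    filter_upwards [hC] with x hx
    rw [norm_mul, mul_comm]
    exact mul_le_mul_of_nonneg_right hx (norm_nonneg _)
  refine (sq_integral_le_integral_sq hfg).trans ?_
  rw [← integral_const_mul]
  refine integral_mono_ae hfg.integrable_sq (hf.integrable_sq.const_mul _) ?_
  filter_upwards [hC] with x hx
  have h1 : g x ^ 2 ≤ C ^ 2 := sq_le_sq' (neg_le_of_abs_le hx) (le_of_abs_le hx)
  have h2 := mul_le_mul_of_nonneg_right h1 (sq_nonneg (f x))
  calc (f x * g x) ^ 2 = g x ^ 2 * f x ^ 2 := by ring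
    _ ≤ C ^ 2 * f x ^ 2 := h2

theorem integral_condExp_mul_condExp {Ω : Type*} {m : MeasurableSpace Ω} [mΩ : MeasurableSpace Ω]
    {ν : Measure Ω} [IsProbabilityMeasure ν] (hm : m ≤ mΩ) {F G : Ω → ℝ} (hF : MemLp F 2 ν)
    (hG : MemLp G 2 ν) :
    ∫ x, (ν[F | m]) x * (ν[G | m]) x ∂ν = ∫ x, F x * (ν[G | m]) x ∂ν := by
  have hG' := hG.condExp (m := m) one_le_two
  have h := condExp_mul_of_stronglyMeasurable_right (m := m) (μ := ν) (f := F) (g := ν[G | m])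
    stronglyMeasurable_condExp (hF.integrable_mul hG') (hF.integrable one_le_two)
  rw [← integral_condExp hm (f := fun x => F x * (ν[G | m]) x)]
  exact (integral_congr_ae h).symm

end L2

/-! ### Integrals over cubes and the Cauchy–Schwarz–Gowers inequality. -/

section CubeIntegral

variable {X : Type*} [MeasurableSpace X] [StandardBorelSpace X] {μ : Measure X}
  [IsProbabilityMeasure μ] {T : X → X}

theorem prod_cubeGlue {X : Type*} {k : ℕ} (f : (Fin (k + 1) → Bool) → X → ℝ)
    (p : Cube X k × Cube X k) :
    ∏ ε, f ε (cubeGlue k p ε)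
      = (∏ ε : Fin k → Bool, f (Fin.snoc (α := fun _ => Bool) ε false) (p.1 ε))
        * ∏ ε : Fin k → Bool, f (Fin.snoc (α := fun _ => Bool) ε true) (p.2 ε) := by
  rw [← (Fin.snocEquiv fun _ => Bool).prod_comp, Fintype.prod_prod_type, Fintype.prod_bool,
    mul_comm]
  congr 1 <;>
  · refine Finset.prod_congr rfl fun ε _ => ?_
    congr 1
    simp [cubeGlue, Fin.snocEquiv]

omit [StandardBorelSpace X] in
theorem measurable_prod_cube {k : ℕ} {f : (Fin k → Bool) → X → ℝ} (hf : ∀ ε, Measurable (f ε)) :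
    Measurable fun x : Cube X k => ∏ ε, f ε (x ε) :=
  Finset.measurable_prod _ fun ε _ => (hf ε).comp (measurable_pi_apply ε)

omit [MeasurableSpace X] [StandardBorelSpace X] in
theorem abs_prod_cube_le {k : ℕ} {f : (Fin k → Bool) → X → ℝ} {C : (Fin k → Bool) → ℝ}
    (hC : ∀ ε x, |f ε x| ≤ C ε) (x : Cube X k) : |∏ ε, f ε (x ε)| ≤ ∏ ε, C ε := by
  rw [Finset.abs_prod]
  exact Finset.prod_le_prod (fun _ _ => abs_nonneg _) fun ε _ => hC ε _

theorem integral_cubeMeasure_succ (T : X → X) (μ : Measure X) [IsProbabilityMeasure μ] {k : ℕ}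
    {f : (Fin (k + 1) → Bool) → X → ℝ}
    (hf : ∀ ε, Measurable (f ε)) {C : (Fin (k + 1) → Bool) → ℝ} (hC : ∀ ε x, |f ε x| ≤ C ε) :
    ∫ x, ∏ ε, f ε (x ε) ∂(cubeMeasure T μ (k + 1))
      = ∫ x, ((cubeMeasure T μ k)[fun x : Cube X k => ∏ ε,
            f (Fin.snoc (α := fun _ => Bool) ε false) (x ε)
            | MeasurableSpace.invariants (cubeMap T k)]) x
          * ((cubeMeasure T μ k)[fun x : Cube X k => ∏ ε,
            f (Fin.snoc (α := fun _ => Bool) ε true) (x ε)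
            | MeasurableSpace.invariants (cubeMap T k)]) x ∂(cubeMeasure T μ k) := by
  rw [← integral_comp_of_measurePreserving (measurePreserving_cubeGlue T μ k)
    (measurable_prod_cube hf).aestronglyMeasurable]
  simp_rw [prod_cubeGlue]
  exact integral_relIndepSquare _ (MeasurableSpace.invariants_le _)
    (measurable_prod_cube fun ε => hf _) (measurable_prod_cube fun ε => hf _)
    (abs_prod_cube_le fun ε => hC _) (abs_prod_cube_le fun ε => hC _)

theorem integral_prod_cubeMeasure_eq_sq (T : X → X) (μ : Measure X) [IsProbabilityMeasure μ]
    {k : ℕ} {f : X → ℝ} (hf : Measurable f) {C : ℝ} (hC : ∀ x, |f x| ≤ C) :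
    ∫ x, ∏ ε, f (x ε) ∂(cubeMeasure T μ (k + 1))
      = ∫ x, ((cubeMeasure T μ k)[fun x : Cube X k => ∏ ε, f (x ε)
            | MeasurableSpace.invariants (cubeMap T k)]) x ^ 2 ∂(cubeMeasure T μ k) := by
  simp_rw [sq]
  exact integral_cubeMeasure_succ T μ (fun _ => hf) (fun _ => hC)

theorem integral_prod_cubeMeasure_nonneg (T : X → X) (μ : Measure X) [IsProbabilityMeasure μ]
    {k : ℕ} (hk : k ≠ 0) {f : X → ℝ} (hf : Measurable f) {C : ℝ} (hC : ∀ x, |f x| ≤ C) :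
    0 ≤ ∫ x, ∏ ε, f (x ε) ∂(cubeMeasure T μ k) := by
  obtain ⟨k, rfl⟩ := Nat.exists_eq_succ_of_ne_zero hk
  rw [integral_prod_cubeMeasure_eq_sq T μ hf hC]
  exact integral_nonneg fun _ => sq_nonneg _

theorem seminorm_pow (T : X → X) (μ : Measure X) [IsProbabilityMeasure μ]
    {k : ℕ} (hk : k ≠ 0) {f : X → ℝ} (hf : Measurable f) {C : ℝ} (hC : ∀ x, |f x| ≤ C) :
    seminorm T μ k f ^ 2 ^ k = ∫ x, ∏ ε, f (x ε) ∂(cubeMeasure T μ k) := by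
  rw [seminorm, ← Real.rpow_natCast, ← Real.rpow_mul
    (integral_prod_cubeMeasure_nonneg T μ hk hf hC)]
  simp

theorem seminorm_nonneg (T : X → X) (μ : Measure X) [IsProbabilityMeasure μ]
    {k : ℕ} (hk : k ≠ 0) {f : X → ℝ} (hf : Measurable f) {C : ℝ} (hC : ∀ x, |f x| ≤ C) :
    0 ≤ seminorm T μ k f :=
  Real.rpow_nonneg (integral_prod_cubeMeasure_nonneg T μ hk hf hC) _

omit [StandardBorelSpace X] in
theorem memLp_prod_cube {k : ℕ} {f : (Fin k → Bool) → X → ℝ} (hf : ∀ ε, Measurable (f ε))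
    {C : (Fin k → Bool) → ℝ} (hC : ∀ ε x, |f ε x| ≤ C ε) (ν : Measure (Cube X k))
    [IsFiniteMeasure ν] : MemLp (fun x : Cube X k => ∏ ε, f ε (x ε)) 2 ν :=
  memLp_of_abs_le (measurable_prod_cube hf) (abs_prod_cube_le hC) 2

omit [MeasurableSpace X] [StandardBorelSpace X] in
theorem cubeMap_iterate (T : X → X) (k n : ℕ) (x : Cube X k) (ε : Fin k → Bool) :
    (cubeMap T k)^[n] x ε = T^[n] (x ε) := by
  induction n generalizing x with
  | zero => rfl
  | succ n ih => rw [Function.iterate_succ_apply, ih, Function.iterate_succ_apply]; rfl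

theorem integral_mul_birkhoffAverage_cube (hT : MeasurePreserving T μ μ) {k : ℕ}
    {f g : (Fin k → Bool) → X → ℝ} (hf : ∀ ε, Measurable (f ε)) (hg : ∀ ε, Measurable (g ε))
    {C D : (Fin k → Bool) → ℝ} (hC : ∀ ε x, |f ε x| ≤ C ε) (hD : ∀ ε x, |g ε x| ≤ D ε) (N : ℕ) :
    ∫ x, (∏ ε, f ε (x ε)) * birkhoffAverage ℝ (cubeMap T k) (fun x => ∏ ε, g ε (x ε)) N x
        ∂(cubeMeasure T μ k)
      = (N : ℝ)⁻¹ * ∑ n ∈ Finset.range N,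
          ∫ x, ∏ ε, (f ε (x ε) * g ε (T^[n] (x ε))) ∂(cubeMeasure T μ k) := by
  have h1 : ∀ x, birkhoffAverage ℝ (cubeMap T k) (fun x => ∏ ε, g ε (x ε)) N x
      = (N : ℝ)⁻¹ * ∑ n ∈ Finset.range N, ∏ ε, g ε (T^[n] (x ε)) := by
    intro x
    simp only [birkhoffAverage, birkhoffSum, cubeMap_iterate, smul_eq_mul]
  have h2 : ∀ x : Cube X k,
      (∏ ε, f ε (x ε)) * birkhoffAverage ℝ (cubeMap T k) (fun x => ∏ ε, g ε (x ε)) N x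
      = (N : ℝ)⁻¹ * ∑ n ∈ Finset.range N, ∏ ε, (f ε (x ε) * g ε (T^[n] (x ε))) := by
    intro x
    rw [h1, mul_left_comm, Finset.mul_sum]
    simp_rw [Finset.prod_mul_distrib]
  simp_rw [h2]
  rw [integral_const_mul, integral_finsetSum]
  intro n _
  refine (memLp_prod_cube (f := fun ε y => f ε y * g ε (T^[n] y))
    (fun ε => (hf ε).mul ((hg ε).comp (hT.measurable.iterate n))) (C := fun ε => C ε * D ε)
    (fun ε y => ?_) _).integrable one_le_two
  rw [abs_mul]
  exact mul_le_mul (hC _ _) (hD _ _) (abs_nonneg _) ((abs_nonneg _).trans (hC ε y))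

/-- The mean ergodic theorem replaces the conditional expectation of one half of the cube by
averages along `T`, which reduces integrals in dimension `k + 1` to dimension `k`. -/
theorem tendsto_average_integral_prod (hT : MeasurePreserving T μ μ) {k : ℕ}
    {f : (Fin (k + 1) → Bool) → X → ℝ} (hf : ∀ ε, Measurable (f ε))
    {C : (Fin (k + 1) → Bool) → ℝ} (hC : ∀ ε x, |f ε x| ≤ C ε) :
    Tendsto (fun N : ℕ => (N : ℝ)⁻¹ * ∑ n ∈ Finset.range N,
        ∫ x, ∏ ε, (f (Fin.snoc (α := fun _ => Bool) ε false) (x ε)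
          * f (Fin.snoc (α := fun _ => Bool) ε true) (T^[n] (x ε))) ∂(cubeMeasure T μ k)) atTop
      (𝓝 (∫ x, ∏ ε, f ε (x ε) ∂(cubeMeasure T μ (k + 1)))) := by
  have hF := memLp_prod_cube (fun ε => hf (Fin.snoc (α := fun _ => Bool) ε false))
    (fun ε => hC _) (cubeMeasure T μ k)
  have hG := memLp_prod_cube (fun ε => hf (Fin.snoc (α := fun _ => Bool) ε true))
    (fun ε => hC _) (cubeMeasure T μ k)
  rw [integral_cubeMeasure_succ T μ hf hC,
    integral_condExp_mul_condExp (MeasurableSpace.invariants_le _) hF hG]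
  refine (tendsto_integral_mul_birkhoffAverage (measurePreserving_cubeMap_self hT k) hG hF).congr
    fun N => ?_
  exact integral_mul_birkhoffAverage_cube hT (fun ε => hf _) (fun ε => hf _) (fun ε => hC _)
    (fun ε => hC _) N

theorem tendsto_integral_birkhoffAverage_sq_cube (hT : MeasurePreserving T μ μ) (k : ℕ)
    {f : X → ℝ} (hf : Measurable f) {C : ℝ} (hC : ∀ x, |f x| ≤ C) :
    Tendsto (fun N => ∫ x, birkhoffAverage ℝ (cubeMap T k) (fun x => ∏ ε, f (x ε)) N x ^ 2
      ∂(cubeMeasure T μ k)) atTop (𝓝 (∫ x, ∏ ε, f (x ε) ∂(cubeMeasure T μ (k + 1)))) := by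
  rw [integral_prod_cubeMeasure_eq_sq T μ hf hC]
  exact tendsto_integral_birkhoffAverage_sq (measurePreserving_cubeMap_self hT k)
    (memLp_prod_cube (fun _ => hf) (fun _ => hC) _)

theorem integral_birkhoffAverage_sq_cube (hT : MeasurePreserving T μ μ) (k : ℕ)
    {f : X → ℝ} (hf : Measurable f) {C : ℝ} (hC : ∀ x, |f x| ≤ C) (H : ℕ) :
    ∫ x, birkhoffAverage ℝ (cubeMap T k) (fun x => ∏ ε, f (x ε)) H x ^ 2 ∂(cubeMeasure T μ k)
      = ∑ h ∈ Finset.range H, ∑ h' ∈ Finset.range H, ((H : ℝ)⁻¹ * (H : ℝ)⁻¹) *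
          ∫ x, ∏ ε, (f (T^[h] (x ε)) * f (T^[h'] (x ε))) ∂(cubeMeasure T μ k) := by
  have h1 : ∀ x : Cube X k, birkhoffAverage ℝ (cubeMap T k) (fun x => ∏ ε, f (x ε)) H x ^ 2
      = ∑ h ∈ Finset.range H, ∑ h' ∈ Finset.range H, ((H : ℝ)⁻¹ * (H : ℝ)⁻¹) *
          ∏ ε, (f (T^[h] (x ε)) * f (T^[h'] (x ε))) := by
    intro x
    simp only [birkhoffAverage, birkhoffSum, cubeMap_iterate, smul_eq_mul,
      Finset.prod_mul_distrib, sq]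
    rw [mul_mul_mul_comm, Finset.sum_mul_sum, Finset.mul_sum]
    simp_rw [Finset.mul_sum]
  have hint : ∀ h h', Integrable (fun x : Cube X k =>
      ∏ ε, (f (T^[h] (x ε)) * f (T^[h'] (x ε)))) (cubeMeasure T μ k) := fun h h' => by
    refine (memLp_prod_cube (f := fun _ y => f (T^[h] y) * f (T^[h'] y))
      (fun _ => (hf.comp (hT.measurable.iterate h)).mul (hf.comp (hT.measurable.iterate h')))
      (C := fun _ => C * C) (fun ε y => ?_) _).integrable one_le_two
    rw [abs_mul]
    exact mul_le_mul (hC _) (hC _) (abs_nonneg _) ((abs_nonneg _).trans (hC y))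
  simp_rw [h1]
  rw [integral_finsetSum _ fun h _ => integrable_finsetSum _ fun h' _ =>
    (hint h h').const_mul _]
  refine Finset.sum_congr rfl fun h _ => ?_
  rw [integral_finsetSum _ fun h' _ => (hint h h').const_mul _]
  exact Finset.sum_congr rfl fun h' _ => integral_const_mul _ _

/-- A form of the Cauchy–Schwarz–Gowers inequality. -/
theorem abs_integral_prod_cube_pow_le (hT : MeasurePreserving T μ μ) (k : ℕ)
    {f : (Fin (k + 1) → Bool) → X → ℝ} (hf : ∀ ε, Measurable (f ε)) {C : ℝ}
    (hC : ∀ x, |f (fun _ => false) x| ≤ C) (h1 : ∀ ε, (ε ≠ fun _ => false) → ∀ x, |f ε x| ≤ 1) :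
    |∫ x, ∏ ε, f ε (x ε) ∂(cubeMeasure T μ (k + 1))| ^ 2 ^ (k + 1)
      ≤ ∫ x, ∏ ε, f (fun _ => false) (x ε) ∂(cubeMeasure T μ (k + 1)) := by
  have hbd : ∀ {k : ℕ} {f : (Fin (k + 1) → Bool) → X → ℝ} {C : ℝ},
      (∀ x, |f (fun _ => false) x| ≤ C) → (∀ ε, (ε ≠ fun _ => false) → ∀ x, |f ε x| ≤ 1) →
      ∀ ε x, |f ε x| ≤ max C 1 := by
    intro k f C hC h1 ε x
    by_cases h : ε = fun _ => false
    · subst h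
      exact (hC x).trans (le_max_left _ _)
    · exact (h1 ε h x).trans (le_max_right _ _)
  -- Cauchy–Schwarz between the two halves of the cube, discarding a half bounded by 1.
  have hcs : ∀ {k : ℕ} {F H : Cube X k → ℝ}, MemLp F 2 (cubeMeasure T μ k) → Measurable H →
      (∀ x, |H x| ≤ 1) →
      (∫ x, ((cubeMeasure T μ k)[F | MeasurableSpace.invariants (cubeMap T k)]) x *
        ((cubeMeasure T μ k)[H | MeasurableSpace.invariants (cubeMap T k)]) x
        ∂(cubeMeasure T μ k)) ^ 2 ≤
      ∫ x, ((cubeMeasure T μ k)[F | MeasurableSpace.invariants (cubeMap T k)]) x ^ 2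
        ∂(cubeMeasure T μ k) := by
    intro k F H hF hH hH1
    have := sq_integral_mul_le (ν := cubeMeasure T μ k) (C := 1)
      (hF.condExp (m := MeasurableSpace.invariants (cubeMap T k)) one_le_two)
      (g := (cubeMeasure T μ k)[H | MeasurableSpace.invariants (cubeMap T k)])
      integrable_condExp.aestronglyMeasurable
      (ae_bdd_abs_condExp_of_ae_bdd_abs (ae_of_all _ hH1))
    simpa using this
  have hfalse : ∀ {k : ℕ}, Fin.snoc (α := fun _ => Bool) (fun _ : Fin k => false) false
      = fun _ => false := by
    intro k
    funext i
    refine Fin.lastCases ?_ (fun j => ?_) i <;> simp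
  have htrue : ∀ {k : ℕ} (ε : Fin k → Bool),
      (Fin.snoc (α := fun _ => Bool) ε true : Fin (k + 1) → Bool) ≠ fun _ => false := by
    intro k ε h
    have := congrFun h (Fin.last k)
    simp at this
  induction k generalizing C with
  | zero =>
    rw [integral_cubeMeasure_succ T μ hf (hbd hC h1),
      integral_prod_cubeMeasure_eq_sq T μ (hf _) hC]
    simp only [zero_add, pow_one, sq_abs]
    have h2 : ∀ ε : Fin 0 → Bool, Fin.snoc (α := fun _ => Bool) ε false = fun _ => false :=
      fun ε => by rw [Subsingleton.elim ε fun _ => false]; exact hfalse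
    simp_rw [h2]
    refine hcs (memLp_prod_cube (fun _ => hf _) (fun _ => hC) _)
      (measurable_prod_cube fun _ => hf _) fun x => ?_
    simpa using abs_prod_cube_le (C := fun _ => 1) (fun ε => h1 _ (htrue ε)) x
  | succ k ih =>
    set f₀ := f fun _ => false
    set f₁ := f (Fin.snoc (α := fun _ => Bool) (fun _ : Fin (k + 1) => false) true)
    have hf₁ : ∀ x, |f₁ x| ≤ 1 := h1 _ (htrue _)
    set a : ℕ → ℝ := fun n => ∫ x, ∏ ε, (f (Fin.snoc (α := fun _ => Bool) ε false) (x ε)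
          * f (Fin.snoc (α := fun _ => Bool) ε true) (T^[n] (x ε))) ∂(cubeMeasure T μ (k + 1))
    set b : ℕ → ℝ := fun n => ∫ x, ∏ ε, (f₀ (x ε) * f₁ (T^[n] (x ε)))
      ∂(cubeMeasure T μ (k + 1))
    have hla := tendsto_average_integral_prod hT hf (hbd hC h1)
    have hlb := tendsto_average_integral_prod hT (k := k + 1)
      (f := fun ε => bif ε (Fin.last (k + 1)) then f₁ else f₀) (C := fun _ => max C 1)
      (fun ε => by cases ε (Fin.last (k + 1)) <;> exact hf _)
      (fun ε x => by cases ε (Fin.last (k + 1)) <;> exact hbd hC h1 _ _)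
    simp only [Fin.snoc_last, cond_true, cond_false] at hlb
    -- The induction hypothesis applies to the products along edges in the last direction; only the
    -- edge at `0⋯0`, carrying `f₀` and `f₁`, survives.
    have hab : ∀ n, |a n| ^ 2 ^ (k + 1) ≤ b n := by
      intro n
      have hb' : ∀ ε : Fin (k + 1) → Bool, (ε ≠ fun _ => false) → ∀ x,
          |f (Fin.snoc (α := fun _ => Bool) ε false) x
            * f (Fin.snoc (α := fun _ => Bool) ε true) (T^[n] x)| ≤ 1 := by
        intro ε hε x
        rw [abs_mul]
        refine mul_le_one₀ (h1 _ (fun h => hε ?_) _) (abs_nonneg _) (h1 _ (htrue ε) _)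
        funext i
        have := congrFun h i.castSucc
        simpa using this
      have := ih (C := C) (f := fun ε x => f (Fin.snoc (α := fun _ => Bool) ε false) x
            * f (Fin.snoc (α := fun _ => Bool) ε true) (T^[n] x))
        (fun ε => (hf _).mul ((hf _).comp (hT.measurable.iterate n))) (fun x => ?_) hb'
      · simpa only [hfalse] using this
      · rw [hfalse, abs_mul]
        exact (mul_le_of_le_one_right (abs_nonneg _) (hf₁ _)).trans (hC x)
    -- Jensen for the power `2 ^ (k + 1)`; the bound is then stable under `N → ∞`.
    have havg : ∀ N : ℕ, |(N : ℝ)⁻¹ * ∑ n ∈ Finset.range N, a n| ^ 2 ^ (k + 1)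
        ≤ (N : ℝ)⁻¹ * ∑ n ∈ Finset.range N, b n := by
      intro N
      rcases Nat.eq_zero_or_pos N with rfl | hN
      · simp
      have hN' : (N : ℝ) ≠ 0 := by positivity
      calc |(N : ℝ)⁻¹ * ∑ n ∈ Finset.range N, a n| ^ 2 ^ (k + 1)
          ≤ (∑ n ∈ Finset.range N, (N : ℝ)⁻¹ * |a n|) ^ 2 ^ (k + 1) := by
            refine pow_le_pow_left₀ (abs_nonneg _) ?_ _
            rw [abs_mul, abs_of_nonneg (by positivity : (0 : ℝ) ≤ (N : ℝ)⁻¹), ← Finset.mul_sum]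
            exact mul_le_mul_of_nonneg_left (Finset.abs_sum_le_sum_abs _ _) (by positivity)
        _ ≤ ∑ n ∈ Finset.range N, (N : ℝ)⁻¹ * |a n| ^ 2 ^ (k + 1) := by
            refine Real.pow_arith_mean_le_arith_mean_pow _ _ _ (fun _ _ => by positivity) ?_
              (fun _ _ => abs_nonneg _) _
            simp [hN']
        _ ≤ (N : ℝ)⁻¹ * ∑ n ∈ Finset.range N, b n := by
            rw [← Finset.mul_sum]
            exact mul_le_mul_of_nonneg_left (Finset.sum_le_sum fun n _ => hab n) (by positivity)
    have hlim := le_of_tendsto_of_tendsto' (hla.abs.pow (2 ^ (k + 1))) hlb havg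
    -- A last Cauchy–Schwarz removes `f₁` and accounts for the final doubling of the exponent.
    have hfin := hcs (k := k + 1) (F := fun x => ∏ ε, f₀ (x ε)) (H := fun x => ∏ ε, f₁ (x ε))
      (memLp_prod_cube (fun _ => hf _) (fun _ => hC) _)
      (measurable_prod_cube fun _ => hf _)
      (fun x => by simpa using abs_prod_cube_le (C := fun _ => 1) (fun ε => hf₁) x)
    rw [integral_cubeMeasure_succ T μ (k := k + 1)
      (f := fun ε => bif ε (Fin.last (k + 1)) then f₁ else f₀) (C := fun _ => max C 1)
      (fun ε => by cases ε (Fin.last (k + 1)) <;> exact hf _)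
      (fun ε x => by cases ε (Fin.last (k + 1)) <;> exact hbd hC h1 _ _)] at hlim
    simp only [Fin.snoc_last, cond_true, cond_false] at hlim
    rw [integral_prod_cubeMeasure_eq_sq T μ (hf _) hC, pow_succ 2 (k + 1), pow_mul]
    refine (pow_le_pow_left₀ (by positivity) hlim 2).trans hfin

end CubeIntegral

end HostKra

namespace HostKra

/-! ### Van der Corput's inequality. -/

section VanDerCorput

/-- Cesàro averages are Birkhoff averages of the successor map, which asymptotically forget the
starting point. -/
theorem tendsto_average_shift_sub {E : Type*} [NormedAddCommGroup E] [NormedSpace ℝ E]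
    {u : ℕ → E} {C : ℝ} (hC : ∀ n, ‖u n‖ ≤ C) (h : ℕ) :
    Tendsto (fun N : ℕ => (N : ℝ)⁻¹ • ∑ n ∈ Finset.range N, u (n + h)
      - (N : ℝ)⁻¹ • ∑ n ∈ Finset.range N, u n) atTop (𝓝 0) := by
  have hb : ∀ N j : ℕ, birkhoffAverage ℝ Nat.succ u N j
      = (N : ℝ)⁻¹ • ∑ n ∈ Finset.range N, u (n + j) := by
    intro N j
    simp only [birkhoffAverage, birkhoffSum, Nat.succ_iterate, add_comm]
  induction h with
  | zero => simp
  | succ h ih =>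
    have h1 := tendsto_birkhoffAverage_apply_sub_birkhoffAverage (f := Nat.succ) (g := u) (x := h)
      ℝ (isBounded_iff_forall_norm_le.2 ⟨C, by rintro _ ⟨n, rfl⟩; exact hC _⟩)
    have h2 := h1.add ih
    simp only [hb, add_zero] at h2
    refine h2.congr fun N => ?_
    abel

theorem norm_sq_average_le {E : Type*} [NormedAddCommGroup E] [InnerProductSpace ℝ E]
    (w : ℕ → E) (N : ℕ) :
    ‖(N : ℝ)⁻¹ • ∑ n ∈ Finset.range N, w n‖ ^ 2
      ≤ (N : ℝ)⁻¹ * ∑ n ∈ Finset.range N, ‖w n‖ ^ 2 := by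
  rcases Nat.eq_zero_or_pos N with rfl | hN
  · simp
  have hN' : (N : ℝ) ≠ 0 := by positivity
  calc ‖(N : ℝ)⁻¹ • ∑ n ∈ Finset.range N, w n‖ ^ 2
      ≤ (∑ n ∈ Finset.range N, (N : ℝ)⁻¹ * ‖w n‖) ^ 2 := by
        refine pow_le_pow_left₀ (norm_nonneg _) ?_ _
        rw [norm_smul, Real.norm_of_nonneg (by positivity), ← Finset.mul_sum]
        exact mul_le_mul_of_nonneg_left (norm_sum_le _ _) (by positivity)
    _ ≤ ∑ n ∈ Finset.range N, (N : ℝ)⁻¹ * ‖w n‖ ^ 2 := by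
        refine Real.pow_arith_mean_le_arith_mean_pow _ _ _ (fun _ _ => by positivity) ?_
          (fun _ _ => norm_nonneg _) _
        simp [hN']
    _ = _ := by rw [Finset.mul_sum]

/-- The van der Corput inequality. -/
theorem eventually_norm_sq_average_le {E : Type*} [NormedAddCommGroup E] [InnerProductSpace ℝ E]
    {u : ℕ → E} {C : ℝ} (hC : ∀ n, ‖u n‖ ≤ C) {B : ℕ → ℕ → ℝ}
    (hB : ∀ h h' : ℕ, ∀ ε : ℝ, 0 < ε → ∀ᶠ N : ℕ in atTop,
      (N : ℝ)⁻¹ * ∑ n ∈ Finset.range N, inner ℝ (u (n + h)) (u (n + h')) ≤ B h h' + ε)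
    {H : ℕ} (hH : H ≠ 0) {ε : ℝ} (hε : 0 < ε) :
    ∀ᶠ N : ℕ in atTop, ‖(N : ℝ)⁻¹ • ∑ n ∈ Finset.range N, u n‖ ^ 2
      ≤ ∑ h ∈ Finset.range H, ∑ h' ∈ Finset.range H, ((H : ℝ)⁻¹ * (H : ℝ)⁻¹) * B h h' + ε := by
  have hH' : (H : ℝ) ≠ 0 := by exact_mod_cast hH
  set A : ℕ → E := fun N => (N : ℝ)⁻¹ • ∑ n ∈ Finset.range N, u n
  -- Smoothing `u` over a window of length `H` changes its averages by a null sequence. Expanding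
  -- `‖w n‖ ^ 2` produces all pairs `h`, `h'`, the diagonal included, which is why `B` bounds the
  -- diagonal too.
  set w : ℕ → E := fun n => (H : ℝ)⁻¹ • ∑ h ∈ Finset.range H, u (n + h)
  set D : ℕ → E := fun N => (N : ℝ)⁻¹ • ∑ n ∈ Finset.range N, w n
  have hbdavg : ∀ (v : ℕ → E), (∀ n, ‖v n‖ ≤ C) → ∀ N : ℕ,
      ‖(N : ℝ)⁻¹ • ∑ n ∈ Finset.range N, v n‖ ≤ C := by
    intro v hv N
    rcases Nat.eq_zero_or_pos N with rfl | hN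
    · simpa using (norm_nonneg _).trans (hC 0)
    rw [norm_smul, norm_inv, Real.norm_natCast, inv_mul_le_iff₀ (by exact_mod_cast hN)]
    refine (norm_sum_le _ _).trans ((Finset.sum_le_sum fun n _ => hv n).trans ?_)
    simp
  have hA : ∀ N, ‖A N‖ ≤ C := hbdavg u hC
  have hw : ∀ n, ‖w n‖ ≤ C := fun n => hbdavg (fun h => u (n + h)) (fun h => hC _) H
  have hD : ∀ N, ‖D N‖ ≤ C := hbdavg w hw
  have hDA : Tendsto (fun N => D N - A N) atTop (𝓝 0) := by
    have h1 : Tendsto (fun N : ℕ => (H : ℝ)⁻¹ • ∑ h ∈ Finset.range H,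
        ((N : ℝ)⁻¹ • ∑ n ∈ Finset.range N, u (n + h) - A N)) atTop (𝓝 0) := by
      have := (tendsto_finsetSum (Finset.range H) fun h _ =>
        tendsto_average_shift_sub hC h).const_smul (H : ℝ)⁻¹
      simpa using this
    refine h1.congr fun N => ?_
    rw [Finset.sum_sub_distrib, smul_sub, Finset.sum_const, Finset.card_range,
      ← Nat.cast_smul_eq_nsmul ℝ, smul_smul, inv_mul_cancel₀ hH', one_smul]
    congr 1
    simp only [D, w, Finset.smul_sum]
    rw [Finset.sum_comm]
    simp_rw [smul_comm (H : ℝ)⁻¹]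
  have hsq : Tendsto (fun N => ‖A N‖ ^ 2 - ‖D N‖ ^ 2) atTop (𝓝 0) := by
    have hC0 : 0 ≤ C := (norm_nonneg _).trans (hC 0)
    refine squeeze_zero_norm (a := fun N => ‖D N - A N‖ * (2 * C)) (fun N => ?_) ?_
    · have e : ‖A N‖ ^ 2 - ‖D N‖ ^ 2 = (‖A N‖ - ‖D N‖) * (‖A N‖ + ‖D N‖) := by ring
      rw [e, norm_mul]
      refine mul_le_mul ?_ ?_ (norm_nonneg _) (norm_nonneg _)
      · rw [Real.norm_eq_abs, norm_sub_rev]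
        exact abs_norm_sub_norm_le _ _
      · rw [Real.norm_of_nonneg (by positivity)]
        linarith [hA N, hD N]
    · simpa using hDA.norm.mul_const (2 * C)
  have hwexp : ∀ n, ‖w n‖ ^ 2 = ∑ h ∈ Finset.range H, ∑ h' ∈ Finset.range H,
      ((H : ℝ)⁻¹ * (H : ℝ)⁻¹) * inner ℝ (u (n + h)) (u (n + h')) := by
    intro n
    rw [← real_inner_self_eq_norm_sq]
    simp only [w]
    rw [real_inner_smul_left, real_inner_smul_right, sum_inner, ← mul_assoc, Finset.mul_sum]
    simp_rw [inner_sum, Finset.mul_sum]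
  have hall : ∀ᶠ N : ℕ in atTop, ∀ p ∈ Finset.range H ×ˢ Finset.range H,
      (N : ℝ)⁻¹ * ∑ n ∈ Finset.range N, inner ℝ (u (n + p.1)) (u (n + p.2))
        ≤ B p.1 p.2 + ε / 2 :=
    (Finset.eventually_all _).2 fun p _ => hB p.1 p.2 (ε / 2) (half_pos hε)
  filter_upwards [hall, hsq.eventually_lt_const (half_pos hε)] with N h1 h2
  have h3 : ‖D N‖ ^ 2 ≤ ∑ h ∈ Finset.range H, ∑ h' ∈ Finset.range H,
      ((H : ℝ)⁻¹ * (H : ℝ)⁻¹) * (B h h' + ε / 2) := by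
    refine (norm_sq_average_le w N).trans ?_
    simp_rw [hwexp]
    rw [Finset.sum_comm, Finset.mul_sum]
    refine Finset.sum_le_sum fun h hh => ?_
    rw [Finset.sum_comm, Finset.mul_sum]
    refine Finset.sum_le_sum fun h' hh' => ?_
    rw [← Finset.mul_sum, mul_left_comm]
    exact mul_le_mul_of_nonneg_left (h1 (h, h') (Finset.mk_mem_product hh hh')) (by positivity)
  have h4 : ∑ h ∈ Finset.range H, ∑ h' ∈ Finset.range H,
      ((H : ℝ)⁻¹ * (H : ℝ)⁻¹) * (B h h' + ε / 2)
      = ∑ h ∈ Finset.range H, ∑ h' ∈ Finset.range H, ((H : ℝ)⁻¹ * (H : ℝ)⁻¹) * B h h'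
        + ε / 2 := by
    simp_rw [mul_add, Finset.sum_add_distrib]
    congr 1
    simp only [Finset.sum_const, Finset.card_range, nsmul_eq_mul]
    field_simp
  linarith

/-- The van der Corput inequality for functions in `L²`. -/
theorem eventually_integral_sq_average_le {Ω : Type*} [MeasurableSpace Ω] {ν : Measure Ω}
    [IsProbabilityMeasure ν] {u : ℕ → Ω → ℝ} (hu : ∀ n, Measurable (u n)) {C : ℝ}
    (hC : ∀ n x, |u n x| ≤ C) {B : ℕ → ℕ → ℝ}
    (hB : ∀ h h' : ℕ, ∀ ε : ℝ, 0 < ε → ∀ᶠ N : ℕ in atTop,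
      (N : ℝ)⁻¹ * ∑ n ∈ Finset.range N, ∫ x, u (n + h) x * u (n + h') x ∂ν ≤ B h h' + ε)
    {H : ℕ} (hH : H ≠ 0) {ε : ℝ} (hε : 0 < ε) :
    ∀ᶠ N : ℕ in atTop, ∫ x, ((N : ℝ)⁻¹ * ∑ n ∈ Finset.range N, u n x) ^ 2 ∂ν
      ≤ ∑ h ∈ Finset.range H, ∑ h' ∈ Finset.range H, ((H : ℝ)⁻¹ * (H : ℝ)⁻¹) * B h h' + ε := by
  have hmem : ∀ n, MemLp (u n) 2 ν := fun n => memLp_of_abs_le (hu n) (hC n) 2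
  have hin : ∀ n k, inner ℝ (hmem n).toLp (hmem k).toLp = ∫ x, u n x * u k x ∂ν := by
    intro n k
    rw [L2.inner_def]
    refine integral_congr_ae ?_
    filter_upwards [(hmem n).coeFn_toLp, (hmem k).coeFn_toLp] with x h1 h2
    simp [h1, h2, mul_comm]
  have hnorm : ∀ n, ‖(hmem n).toLp‖ ≤ |C| := by
    intro n
    refine abs_le_of_sq_le_sq' ?_ (abs_nonneg C) |>.2
    rw [← real_inner_self_eq_norm_sq, hin, sq_abs]
    refine (integral_mono_of_nonneg (ae_of_all _ fun x => mul_self_nonneg _)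
      (integrable_const (C ^ 2)) (ae_of_all _ fun x => ?_)).trans (by simp)
    have := mul_self_le_mul_self (abs_nonneg _) (hC n x)
    simpa [sq] using this
  have h1 := eventually_norm_sq_average_le hnorm (B := B) (by simpa only [hin] using hB) hH hε
  filter_upwards [h1] with N hN
  refine le_trans (le_of_eq ?_) hN
  rw [← real_inner_self_eq_norm_sq, L2.inner_def]
  refine integral_congr_ae ?_
  filter_upwards [Lp.coeFn_smul (N : ℝ)⁻¹ (∑ n ∈ Finset.range N, (hmem n).toLp),
    Lp.coeFn_finsetSum (Finset.range N) (fun n => (hmem n).toLp),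
    ae_all_iff.2 fun n => (hmem n).coeFn_toLp] with x h1 h2 h3
  have e : ((N : ℝ)⁻¹ • ∑ n ∈ Finset.range N, (hmem n).toLp : Lp ℝ 2 ν) x
      = (N : ℝ)⁻¹ * ∑ n ∈ Finset.range N, u n x := by
    rw [h1, Pi.smul_apply, h2, Finset.sum_apply]
    simp only [h3, smul_eq_mul]
  rw [e, real_inner_self_eq_norm_sq, Real.norm_eq_abs, sq_abs]

end VanDerCorput

/-! ### The seminorm bound for multiple averages. -/

section MultipleAverages

variable {X : Type*} [MeasurableSpace X] [StandardBorelSpace X] {μ : Measure X}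
  [IsProbabilityMeasure μ]

theorem abs_integral_mul_le {Ω : Type*} [MeasurableSpace Ω] {ν : Measure Ω}
    [IsProbabilityMeasure ν] {f g : Ω → ℝ} (hf : Measurable f) (hg : Measurable g) {C D : ℝ}
    (hC : ∀ x, |f x| ≤ C) (hD : ∀ x, |g x| ≤ D) {K : ℝ} (hK : 0 ≤ K)
    (hint : ∫ x, g x ^ 2 ∂ν ≤ K ^ 2) : |∫ x, f x * g x ∂ν| ≤ C * K := by
  have : Nonempty Ω := nonempty_of_isProbabilityMeasure ν
  have hC0 : 0 ≤ C := (abs_nonneg _).trans (hC (Classical.arbitrary Ω))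
  refine abs_le_of_sq_le_sq ?_ (by positivity)
  have h := sq_integral_mul_le (memLp_of_abs_le hg hD 2) hf.aestronglyMeasurable (ν := ν)
    (ae_of_all _ hC)
  simp_rw [mul_comm (f _)]
  refine h.trans ?_
  rw [mul_pow]
  exact mul_le_mul_of_nonneg_left hint (sq_nonneg _)

-- The change of variable that eliminates one transformation: with `R^[n] x` as the new variable,
-- `A` becomes `A R⁻¹` and `R` itself disappears.
omit [MeasurableSpace X] [StandardBorelSpace X] in
theorem iterate_eq_iterate_iterate {A R : X ≃ X} (h : Function.Commute A R) (n : ℕ) (x : X) :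
    A^[n] x = (fun y => A (R.symm y))^[n] (R^[n] x) := by
  have hc : Function.Commute (fun y => A (R.symm y)) R := fun y => by
    have := h (R.symm y)
    simpa using this
  rw [← Function.comp_apply (f := (fun y => A (R.symm y))^[n]), ← hc.comp_iterate]
  congr 2
  funext y
  simp

omit [MeasurableSpace X] [StandardBorelSpace X] in
theorem commute_symm {A R : X ≃ X} (h : Function.Commute A R) : Function.Commute A R.symm :=
  fun y => by
    apply R.injective
    have := h (R.symm y)
    simpa using this.symm

/-- The average of the `2 ^ k`-th powers of these seminorms is the squared L² norm of an ergodic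
average on the cube of dimension `k`, and tends to the `2 ^ (k + 1)`-th power of the next seminorm.
Convexity then passes to first powers. -/
theorem exists_average_seminorm_le {T : X → X} (hT : MeasurePreserving T μ μ) {k : ℕ}
    (hk : k ≠ 0) {f : X → ℝ} (hf : Measurable f) {C : ℝ} (hC : ∀ x, |f x| ≤ C) {δ : ℝ}
    (hδ : 0 < δ) :
    ∃ H : ℕ, H ≠ 0 ∧ ∑ h ∈ Finset.range H, ∑ h' ∈ Finset.range H, ((H : ℝ)⁻¹ * (H : ℝ)⁻¹) *
      seminorm T μ k (fun x => f (T^[h] x) * f (T^[h'] x)) ≤ seminorm T μ (k + 1) f ^ 2 + δ := by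
  have hg : ∀ h h', Measurable fun x => f (T^[h] x) * f (T^[h'] x) := fun h h' =>
    (hf.comp (hT.measurable.iterate h)).mul (hf.comp (hT.measurable.iterate h'))
  have hgC : ∀ h h' x, |f (T^[h] x) * f (T^[h'] x)| ≤ C * C := fun h h' x => by
    rw [abs_mul]
    exact mul_le_mul (hC _) (hC _) (abs_nonneg _) ((abs_nonneg _).trans (hC x))
  have hlim := tendsto_integral_birkhoffAverage_sq_cube hT k hf hC
  rw [← seminorm_pow T μ (Nat.succ_ne_zero k) hf hC, pow_succ' 2 k, pow_mul] at hlim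
  have hlt : (seminorm T μ (k + 1) f ^ 2) ^ 2 ^ k < (seminorm T μ (k + 1) f ^ 2 + δ) ^ 2 ^ k :=
    pow_lt_pow_left₀ (by linarith) (sq_nonneg _) (by positivity)
  obtain ⟨H, hH, hHlt⟩ := ((eventually_ne_atTop 0).and (hlim.eventually_lt_const hlt)).exists
  refine ⟨H, hH, ?_⟩
  rw [integral_birkhoffAverage_sq_cube hT k hf hC] at hHlt
  refine le_of_pow_le_pow_left₀ (n := 2 ^ k) (by positivity) (by positivity) (le_trans ?_ hHlt.le)
  have hH' : (H : ℝ) ≠ 0 := by exact_mod_cast hH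
  simp_rw [fun h h' => (seminorm_pow T μ hk (hg h h') (hgC h h')).symm]
  rw [← Finset.sum_product', ← Finset.sum_product']
  refine Real.pow_arith_mean_le_arith_mean_pow _ _ _ (fun _ _ => by positivity) ?_
    (fun p _ => seminorm_nonneg T μ hk (hg _ _) (hgC _ _)) _
  simp only [Finset.sum_const, Finset.card_product, Finset.card_range, nsmul_eq_mul]
  push_cast
  field_simp

/-- The multiple ergodic averages over a finite set of commuting transformations are controlled
by the seminorm of any of the functions. -/
theorem eventually_integral_sq_multiple_average_le {ι : Type*} [DecidableEq ι] (l : ℕ) :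
    ∀ (s : Finset ι) (T : ι → X ≃ᵐ X) (f : ι → X → ℝ) (C : ι → ℝ) (i : ι) (ε : ℝ),
      s.card = l + 1 → (∀ a ∈ s, ∀ b ∈ s, Function.Commute (T a) (T b)) →
      (∀ a ∈ s, Ergodic (T a) μ) →
      (∀ a ∈ s, ∀ b ∈ s, a ≠ b → Ergodic (fun x => T a ((T b).symm x)) μ) →
      (∀ a, Measurable (f a)) → (∀ a x, |f a x| ≤ C a) → i ∈ s → 0 < ε →
      ∀ᶠ N : ℕ in atTop,
        ∫ x, ((N : ℝ)⁻¹ * ∑ n ∈ Finset.range N, ∏ a ∈ s, f a ((T a)^[n] x)) ^ 2 ∂μ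
          ≤ ((∏ a ∈ s.erase i, C a) * seminorm (T i) μ (l + 1) (f i)) ^ 2 + ε := by
  induction l with
  | zero =>
    intro s T f C i ε hs _ herg _ hf hC hi hε
    obtain ⟨j, rfl⟩ := Finset.card_eq_one.1 (by simpa using hs)
    obtain rfl : i = j := by simpa using hi
    have hT := (herg i hi).toMeasurePreserving
    -- The cube of dimension 0 is a copy of `X`, so this is the mean ergodic theorem for a single
    -- function.
    have hlim := tendsto_integral_birkhoffAverage_sq_cube hT 0 (hf i) (hC i)
    rw [zero_add, ← seminorm_pow (T i) μ one_ne_zero (hf i) (hC i), pow_one] at hlim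
    simp only [Finset.erase_singleton, Finset.prod_empty, Finset.prod_singleton, one_mul, zero_add]
    filter_upwards [hlim.eventually_le_const (lt_add_of_pos_right _ hε)] with N hN
    refine le_trans (le_of_eq ?_) hN
    rw [← integral_comp_of_measurePreserving (measurePreserving_diag (T i) μ)]
    · simp only [birkhoffAverage, birkhoffSum, cubeMap_iterate, smul_eq_mul]
      simp
    · exact ((measurable_birkhoffAverage (measurable_cubeMap hT.measurable 0)
        (measurable_prod_cube fun _ => hf i) N).pow_const 2).aestronglyMeasurable
  | succ l ih =>
    intro s T f C i ε hs hcomm herg hpair hf hC hi hε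
    obtain ⟨r, hr, hri⟩ : ∃ r ∈ s, r ≠ i := Finset.exists_mem_ne (by omega) i
    have : Nonempty X := nonempty_of_isProbabilityMeasure μ
    have hC0 : ∀ a, 0 ≤ C a := fun a => (abs_nonneg _).trans (hC a (Classical.arbitrary X))
    have hmp : ∀ a ∈ s, ∀ n, MeasurePreserving (T a)^[n] μ μ := fun a ha n =>
      (herg a ha).toMeasurePreserving.iterate n
    have hmeas : ∀ a n, Measurable (T a)^[n] := fun a n => (T a).measurable.iterate n
    -- The maps divided by `T r` satisfy the same hypotheses, since the quotient of `T' a` by `T' b`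
    -- is that of `T a` by `T b`.
    set T' : ι → X ≃ᵐ X := fun a => (T r).symm.trans (T a)
    set g : ℕ → ℕ → ι → X → ℝ := fun h h' a x => f a ((T a)^[h] x) * f a ((T a)^[h'] x)
    have hg : ∀ h h' a, Measurable (g h h' a) := fun h h' a =>
      ((hf a).comp (hmeas a h)).mul ((hf a).comp (hmeas a h'))
    have hgC : ∀ h h' a x, |g h h' a x| ≤ C a * C a := fun h h' a x => by
      simp only [g]
      rw [abs_mul]
      exact mul_le_mul (hC _ _) (hC _ _) (abs_nonneg _) (hC0 a)
    have his : i ∈ s.erase r := Finset.mem_erase.2 ⟨hri.symm, hi⟩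
    have hT'comm : ∀ a ∈ s.erase r, ∀ b ∈ s.erase r, Function.Commute (T' a) (T' b) := by
      intro a ha b hb
      have ha' := Finset.mem_of_mem_erase ha
      have hb' := Finset.mem_of_mem_erase hb
      have h1 : Function.Commute (T a) (T r).symm :=
        commute_symm (R := (T r).toEquiv) (A := (T a).toEquiv) (hcomm a ha' r hr)
      have h2 : Function.Commute (T b) (T r).symm :=
        commute_symm (R := (T r).toEquiv) (A := (T b).toEquiv) (hcomm b hb' r hr)
      exact ((hcomm a ha' b hb').comp_right h1).comp_left
        (h2.symm.comp_right (Function.Commute.refl _))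
    have hT'erg : ∀ a ∈ s.erase r, Ergodic (T' a) μ := fun a ha =>
      hpair a (Finset.mem_of_mem_erase ha) r hr (Finset.ne_of_mem_erase ha)
    have hT'pair : ∀ a ∈ s.erase r, ∀ b ∈ s.erase r, a ≠ b →
        Ergodic (fun x => T' a ((T' b).symm x)) μ := by
      intro a ha b hb hab
      have := hpair a (Finset.mem_of_mem_erase ha) b (Finset.mem_of_mem_erase hb) hab
      have e : (fun x => T' a ((T' b).symm x)) = fun x => T a ((T b).symm x) := by
        funext x
        simp [T']
      rwa [e]
    -- The induction hypothesis speaks of `T' i`, which commutes with `T i`; both are ergodic, so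
    -- their seminorms coincide.
    have hsem : ∀ h h', seminorm (T' i) μ (l + 1) (g h h' i)
        = seminorm (T i) μ (l + 1) (g h h' i) := by
      intro h h'
      refine seminorm_eq_of_commute (hT'erg i his) (herg i hi) ?_ _ _
      exact (Function.Commute.refl _).comp_right
        (commute_symm (R := (T r).toEquiv) (A := (T i).toEquiv) (hcomm i hi r hr))
    set D : ℝ := ∏ a ∈ s.erase i, C a
    have hD : D ^ 2 = C r * C r * ∏ a ∈ (s.erase r).erase i, C a * C a := by
      have : r ∈ s.erase i := Finset.mem_erase.2 ⟨hri, hr⟩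
      simp only [D]
      rw [← Finset.mul_prod_erase _ _ this, Finset.erase_right_comm, Finset.prod_mul_distrib]
      ring
    have hB : ∀ h h' : ℕ, ∀ ε : ℝ, 0 < ε → ∀ᶠ N : ℕ in atTop,
        (N : ℝ)⁻¹ * ∑ n ∈ Finset.range N,
          ∫ x, (∏ a ∈ s, f a ((T a)^[n + h] x)) * (∏ a ∈ s, f a ((T a)^[n + h'] x)) ∂μ
        ≤ D ^ 2 * seminorm (T i) μ (l + 1) (g h h' i) + ε := by
      intro h h' ε hε
      set K : ℝ := (∏ a ∈ (s.erase r).erase i, C a * C a)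
        * seminorm (T i) μ (l + 1) (g h h' i)
      have hK : 0 ≤ K := mul_nonneg (Finset.prod_nonneg fun a _ => mul_nonneg (hC0 a) (hC0 a))
        (seminorm_nonneg _ μ l.succ_ne_zero (hg _ _ _) (hgC _ _ _))
      -- The `+ 1` in the denominator covers `C r = 0`.
      obtain ⟨δ, hδ, hδε⟩ : ∃ δ : ℝ, 0 < δ ∧ C r * C r * δ ≤ ε := by
        refine ⟨ε / (C r * C r + 1), by have := hC0 r; positivity, ?_⟩
        have h0 : 0 ≤ C r * C r := mul_self_nonneg _
        rw [← mul_div_assoc, div_le_iff₀ (by positivity)]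
        nlinarith
      -- The error is `δ ^ 2` because `K ^ 2 + δ ^ 2 ≤ (K + δ) ^ 2`.
      have hih := ih (s.erase r) T' (g h h') (fun a => C a * C a) i (δ ^ 2)
        (by rw [Finset.card_erase_of_mem hr, hs]; rfl) hT'comm hT'erg hT'pair (hg h h') (hgC h h')
        his (by positivity)
      rw [hsem] at hih
      filter_upwards [hih] with N hN
      set A : X → ℝ := fun x => (N : ℝ)⁻¹ * ∑ n ∈ Finset.range N,
        ∏ a ∈ s.erase r, g h h' a ((T' a)^[n] x)
      have hprodm : ∀ n, Measurable fun x => ∏ a ∈ s.erase r, g h h' a ((T' a)^[n] x) := fun n =>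
        Finset.measurable_prod _ fun a _ => (hg h h' a).comp ((T' a).measurable.iterate n)
      have hprodC : ∀ n x, |∏ a ∈ s.erase r, g h h' a ((T' a)^[n] x)|
          ≤ ∏ a ∈ s.erase r, C a * C a := fun n x => by
        rw [Finset.abs_prod]
        exact Finset.prod_le_prod (fun _ _ => abs_nonneg _) fun a _ => hgC _ _ _ _
      have hAm : Measurable A := (Finset.measurable_sum _ fun n _ => hprodm n).const_mul _
      have hAC : ∃ M, ∀ x, |A x| ≤ M := by
        refine ⟨|(N : ℝ)⁻¹| * ∑ n ∈ Finset.range N, ∏ a ∈ s.erase r, C a * C a, fun x => ?_⟩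
        simp only [A]
        rw [abs_mul]
        exact mul_le_mul_of_nonneg_left ((Finset.abs_sum_le_sum_abs _ _).trans
          (Finset.sum_le_sum fun n _ => hprodC n x)) (abs_nonneg _)
      obtain ⟨M, hM⟩ := hAC
      have hterm : ∀ n, ∫ x, (∏ a ∈ s, f a ((T a)^[n + h] x))
          * (∏ a ∈ s, f a ((T a)^[n + h'] x)) ∂μ
          = ∫ x, g h h' r x * ∏ a ∈ s.erase r, g h h' a ((T' a)^[n] x) ∂μ := by
        intro n
        rw [← integral_comp_of_measurePreserving (hmp r hr n)
          (g := fun x => g h h' r x * ∏ a ∈ s.erase r, g h h' a ((T' a)^[n] x))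
          ((hg h h' r).mul (hprodm n)).aestronglyMeasurable]
        congr 1
        funext x
        have e1 : ∀ a j, f a ((T a)^[n + j] x) = f a ((T a)^[j] ((T a)^[n] x)) := fun a j => by
          rw [add_comm, Function.iterate_add_apply]
        simp_rw [e1, ← Finset.prod_mul_distrib]
        rw [← Finset.mul_prod_erase s _ hr]
        congr 1
        refine Finset.prod_congr rfl fun a ha => ?_
        have e2 := iterate_eq_iterate_iterate (A := (T a).toEquiv) (R := (T r).toEquiv)
          (hcomm a (Finset.mem_of_mem_erase ha) r hr) n x
        have e3 : (T a)^[n] x = (T' a)^[n] ((T r)^[n] x) := e2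
        rw [e3]
      have hsum : (N : ℝ)⁻¹ * ∑ n ∈ Finset.range N,
          ∫ x, (∏ a ∈ s, f a ((T a)^[n + h] x)) * (∏ a ∈ s, f a ((T a)^[n + h'] x)) ∂μ
          = ∫ x, g h h' r x * A x ∂μ := by
        simp_rw [hterm]
        rw [← integral_finsetSum, ← integral_const_mul]
        · congr 1
          funext x
          simp only [A]
          rw [← Finset.mul_sum, mul_left_comm]
        · intro n _
          refine (memLp_of_abs_le ((hg h h' r).mul (hprodm n)) (C := C r * C r
            * ∏ a ∈ s.erase r, C a * C a) (fun x => ?_) 1).integrable le_rfl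
          rw [Pi.mul_apply, abs_mul]
          exact mul_le_mul (hgC _ _ _ _) (hprodC _ _) (abs_nonneg _) (mul_self_nonneg _)
      have hle := abs_integral_mul_le (hg h h' r) hAm (hgC h h' r) hM
        (K := K + δ) (by positivity) (hN.trans (by nlinarith))
      rw [hsum]
      calc ∫ x, g h h' r x * A x ∂μ ≤ C r * C r * (K + δ) := (le_abs_self _).trans hle
        _ = D ^ 2 * seminorm (T i) μ (l + 1) (g h h' i) + C r * C r * δ := by
            rw [hD]; ring
        _ ≤ _ := by linarith
    obtain ⟨δ, hδ, hδε⟩ : ∃ δ : ℝ, 0 < δ ∧ D ^ 2 * δ ≤ ε / 2 := by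
      refine ⟨ε / 2 / (D ^ 2 + 1), by positivity, ?_⟩
      rw [← mul_div_assoc, div_le_iff₀ (by positivity)]
      nlinarith [sq_nonneg D]
    obtain ⟨H, hH, hHle⟩ := exists_average_seminorm_le (herg i hi).toMeasurePreserving
      l.succ_ne_zero (hf i) (hC i) hδ
    have hvdc := eventually_integral_sq_average_le (ν := μ)
      (u := fun n x => ∏ a ∈ s, f a ((T a)^[n] x))
      (fun n => Finset.measurable_prod _ fun a _ => (hf a).comp (hmeas a n))
      (C := ∏ a ∈ s, C a) (fun n x => by
        rw [Finset.abs_prod]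
        exact Finset.prod_le_prod (fun _ _ => abs_nonneg _) fun a _ => hC _ _)
      hB hH (half_pos hε)
    filter_upwards [hvdc] with N hN
    refine hN.trans ?_
    have h5 : ∑ h ∈ Finset.range H, ∑ h' ∈ Finset.range H, ((H : ℝ)⁻¹ * (H : ℝ)⁻¹) *
        (D ^ 2 * seminorm (T i) μ (l + 1) (g h h' i))
        ≤ D ^ 2 * (seminorm (T i) μ (l + 1 + 1) (f i) ^ 2 + δ) := by
      refine le_trans (le_of_eq ?_) (mul_le_mul_of_nonneg_left hHle (sq_nonneg D))
      simp_rw [Finset.mul_sum]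
      refine Finset.sum_congr rfl fun h _ => Finset.sum_congr rfl fun h' _ => ?_
      ring
    rw [mul_pow]
    linarith

end MultipleAverages

end HostKra

namespace HostKra

/-! ### Functions of the first coordinate on the relatively independent square. -/

section FirstCoordinate

variable {Ω : Type*} [mΩ : MeasurableSpace Ω] [StandardBorelSpace Ω] {ν : Measure Ω}
  [IsProbabilityMeasure ν] {T : Ω → Ω}

/-- Functions on the relatively independent square over the invariant σ-algebra of `T` which are
invariant under `id × T` depend only on the first coordinate. -/
theorem exists_ae_eq_comp_fst_of_invariant (hT : MeasurePreserving T ν ν) {H : Ω × Ω → ℝ}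
    (hH : Measurable H) {C : ℝ} (hC : ∀ p, |H p| ≤ C)
    (hinv : ∀ᵐ p ∂(relIndepSquare (MeasurableSpace.invariants T) ν), H (p.1, T p.2) = H p) :
    ∃ G : Ω → ℝ, Measurable G ∧ (∀ x, |G x| ≤ C) ∧
      ∀ᵐ p ∂(relIndepSquare (MeasurableSpace.invariants T) ν), H p = G p.1 := by
  have hm := MeasurableSpace.invariants_le T
  set κ : Kernel Ω Ω := ⟨condExpKernel ν (MeasurableSpace.invariants T),
    (condExpKernel ν (MeasurableSpace.invariants T)).measurable.mono hm le_rfl⟩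
  have hκ : ∀ x, κ x = condExpKernel ν (MeasurableSpace.invariants T) x := fun x => rfl
  have : IsMarkovKernel κ := ⟨fun x => by rw [hκ]; infer_instance⟩
  set G : Ω → ℝ := fun x => ∫ y, H (x, y) ∂κ x
  have hG : Measurable G := (hH.stronglyMeasurable.integral_kernel_prod_right' (κ := κ)).measurable
  have hGC : ∀ x, |G x| ≤ C := fun x => by
    have := norm_integral_le_of_norm_le_const (μ := κ x) (f := fun y => H (x, y)) (C := C)
      (ae_of_all _ fun y => hC _)
    simpa using this
  refine ⟨G, hG, hGC, ?_⟩
  have hmeas : MeasurableSet {p : Ω × Ω | H p = G p.1} :=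
    measurableSet_eq_fun hH (hG.comp measurable_fst)
  refine ae_relIndepSquare_of_ae_ae hm hmeas ?_
  rw [relIndepSquare] at hinv
  have h1 := Measure.ae_ae_of_ae_bind (measurable_condExpKernel_prod ν hm).aemeasurable hinv
  filter_upwards [h1, ae_ergodic_condExpKernel hT, ae_ae_condExpKernel_eq (ν := ν) hm]
    with ω a b c
  rw [Measure.ae_prod_iff_ae_ae hmeas]
  filter_upwards [Measure.ae_ae_of_ae_prod a, c] with x hx hκx
  -- The section at `x` is invariant in an ergodic fibre, hence constant. Its value is `G x` because
  -- `x` and `ω` have the same fibre measure.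
  obtain ⟨c, hc⟩ := b.ae_eq_const_of_ae_eq_comp_ae (g := fun y => H (x, y))
    (hH.comp measurable_prodMk_left).aestronglyMeasurable hx
  have hGc : G x = c := by
    simp only [G]
    rw [hκ, hκx, integral_congr_ae hc]
    simp
  filter_upwards [hc] with y hy
  rw [hGc]
  exact hy

end FirstCoordinate

/-! ### Face maps of the cube. -/

section FaceMaps

variable {X : Type*} [MeasurableSpace X] [StandardBorelSpace X] {μ : Measure X}
  [IsProbabilityMeasure μ] {T : X → X}

/-- The transformation acting by `T` on the face `ε i = 1` of the cube. -/
def faceMap {X : Type*} (T : X → X) (k : ℕ) (i : Fin k) : Cube X k → Cube X k :=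
  fun x ε => bif ε i then T (x ε) else x ε

omit [StandardBorelSpace X] in
theorem measurable_faceMap (hT : Measurable T) (k : ℕ) (i : Fin k) :
    Measurable (faceMap T k i) := by
  refine measurable_pi_lambda _ fun ε => ?_
  unfold faceMap
  cases ε i
  · exact measurable_pi_apply ε
  · exact hT.comp (measurable_pi_apply ε)

omit [MeasurableSpace X] [StandardBorelSpace X] in
theorem faceMap_last_cubeGlue (T : X → X) (k : ℕ) (p : Cube X k × Cube X k) :
    faceMap T (k + 1) (Fin.last k) (cubeGlue k p)
      = cubeGlue k (Prod.map _root_.id (cubeMap T k) p) := by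
  funext ε
  cases h : ε (Fin.last k) <;> simp [faceMap, cubeMap, cubeGlue, h]

omit [MeasurableSpace X] [StandardBorelSpace X] in
theorem faceMap_castSucc_cubeGlue (T : X → X) (k : ℕ) (i : Fin k) (p : Cube X k × Cube X k) :
    faceMap T (k + 1) i.castSucc (cubeGlue k p)
      = cubeGlue k (Prod.map (faceMap T k i) (faceMap T k i) p) := by
  funext ε
  cases h : ε (Fin.last k) <;> cases h' : ε i.castSucc <;> simp [faceMap, cubeGlue, h, h']

omit [MeasurableSpace X] [StandardBorelSpace X] in
theorem faceMap_commute (T : X → X) (k : ℕ) (i : Fin k) :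
    Function.Commute (faceMap T k i) (cubeMap T k) := by
  intro x
  funext ε
  cases h : ε i <;> simp [faceMap, cubeMap, h]

/-- On the square, the last face map moves the second factor by the cube map of `T`; every other one
acts diagonally by a face map of the smaller cube, which commutes with the cube map. -/
theorem measurePreserving_faceMap (hT : MeasurePreserving T μ μ) (k : ℕ) (i : Fin k) :
    MeasurePreserving (faceMap T k i) (cubeMeasure T μ k) (cubeMeasure T μ k) := by
  induction k with
  | zero => exact i.elim0
  | succ k ih =>
    have hk := measurePreserving_cubeMap_self hT k
    refine Fin.lastCases ?_ (fun i => ?_) i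
    · exact measurePreserving_of_semiconj (measurePreserving_cubeGlue T μ k)
        (measurePreserving_id_prodMap_relIndepSquare hk) (measurable_faceMap hT.measurable _ _)
        (faceMap_last_cubeGlue T k)
    · exact measurePreserving_of_semiconj (measurePreserving_cubeGlue T μ k)
        (measurePreserving_prodMap_relIndepSquare hk (ih i) (faceMap_commute T k i))
        (measurable_faceMap hT.measurable _ _) (faceMap_castSucc_cubeGlue T k i)

theorem measurePreserving_snd_relIndepSquare {Ω : Type*} {m : MeasurableSpace Ω}
    [mΩ : MeasurableSpace Ω] [StandardBorelSpace Ω] {ν : Measure Ω} [IsProbabilityMeasure ν]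
    (hm : m ≤ mΩ) : MeasurePreserving Prod.snd (relIndepSquare m ν) ν := by
  have := isProbabilityMeasure_relIndepSquare ν hm
  have hswap : (relIndepSquare m ν).map Prod.swap = relIndepSquare m ν := by
    have : IsProbabilityMeasure ((relIndepSquare m ν).map Prod.swap) :=
      Measure.isProbabilityMeasure_map measurable_swap.aemeasurable
    refine ext_relIndepSquare hm fun A B hA hB => ?_
    rw [map_measureReal_apply measurable_swap (hA.prod hB), Set.preimage_swap_prod,
      measureReal_relIndepSquare_prod hm hB hA]
    simp_rw [mul_comm]
  refine ⟨measurable_snd, ?_⟩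
  have e : (Prod.snd : Ω × Ω → Ω) = Prod.fst ∘ Prod.swap := rfl
  rw [e, ← Measure.map_map measurable_fst measurable_swap, hswap,
    (measurePreserving_fst_relIndepSquare hm).map_eq]

theorem measurePreserving_eval (T : X → X) (μ : Measure X) [IsProbabilityMeasure μ] (k : ℕ)
    (ε : Fin k → Bool) : MeasurePreserving (fun x : Cube X k => x ε) (cubeMeasure T μ k) μ := by
  induction k with
  | zero =>
    refine ⟨measurable_pi_apply ε, ?_⟩
    have hd : Measurable fun (x : X) (_ : Fin 0 → Bool) => x :=
      measurable_pi_lambda _ fun _ => measurable_id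
    rw [cubeMeasure_zero, Measure.map_map (measurable_pi_apply ε) hd]
    exact Measure.map_id
  | succ k ih =>
    have hm := MeasurableSpace.invariants_le (cubeMap T k)
    have hcomp : MeasurePreserving (fun p => cubeGlue k p ε)
        (relIndepSquare (MeasurableSpace.invariants (cubeMap T k)) (cubeMeasure T μ k)) μ := by
      unfold cubeGlue
      cases ε (Fin.last k)
      · exact (ih _).comp (measurePreserving_fst_relIndepSquare hm)
      · exact (ih _).comp (measurePreserving_snd_relIndepSquare hm)
    refine ⟨measurable_pi_apply ε, ?_⟩
    rw [cubeMeasure_succ, Measure.map_map (measurable_pi_apply ε) (measurable_cubeGlue k)]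
    exact hcomp.map_eq

/-- Functions on the cube space invariant under the face maps depend only on the coordinate
`00⋯0`. -/
theorem exists_ae_eq_comp_eval_of_faceMap_invariant (hT : MeasurePreserving T μ μ) {C : ℝ}
    (k : ℕ) {H : Cube X k → ℝ} (hH : Measurable H) (hC : ∀ x, |H x| ≤ C)
    (hinv : ∀ i, ∀ᵐ x ∂(cubeMeasure T μ k), H (faceMap T k i x) = H x) :
    ∃ g : X → ℝ, Measurable g ∧ (∀ x, |g x| ≤ C) ∧
      ∀ᵐ x ∂(cubeMeasure T μ k), H x = g (x fun _ => false) := by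
  induction k with
  | zero =>
    refine ⟨fun y => H fun _ => y, hH.comp (measurable_pi_lambda _ fun _ => measurable_id),
      fun y => hC _, ae_of_all _ fun x => ?_⟩
    congr 1
    funext ε
    congr 1
    exact Subsingleton.elim _ _
  | succ k ih =>
    have hk := measurePreserving_cubeMap_self hT k
    have hm := MeasurableSpace.invariants_le (cubeMap T k)
    have hglue := measurePreserving_cubeGlue T μ k
    -- Invariance under the last face map removes the second half of the cube; the other face maps
    -- then descend to the first half.
    obtain ⟨G, hG, hGC, hHG⟩ := exists_ae_eq_comp_fst_of_invariant hk
      (H := fun p => H (cubeGlue k p)) (hH.comp hglue.measurable) (fun p => hC _) (by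
        filter_upwards [hglue.quasiMeasurePreserving.ae (hinv (Fin.last k))] with p hp
        rw [faceMap_last_cubeGlue] at hp
        exact hp)
    have hfst := measurePreserving_fst_relIndepSquare (ν := cubeMeasure T μ k) hm
    obtain ⟨g, hg, hgC, hGg⟩ := ih hG hGC fun i => by
      have hface := measurePreserving_faceMap hT k i
      have hmeas : MeasurableSet {x | G (faceMap T k i x) = G x} :=
        measurableSet_eq_fun (hG.comp hface.measurable) hG
      rw [← hfst.map_eq, ae_map_iff hfst.measurable.aemeasurable hmeas]
      have hpp := measurePreserving_prodMap_relIndepSquare hk hface (faceMap_commute T k i)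
      filter_upwards [hglue.quasiMeasurePreserving.ae (hinv i.castSucc), hHG,
        hpp.quasiMeasurePreserving.ae hHG] with p h1 h2 h3
      rw [faceMap_castSucc_cubeGlue] at h1
      exact (h3.symm.trans h1).trans h2
    refine ⟨g, hg, hgC, ?_⟩
    have hmeas : MeasurableSet {x : Cube X (k + 1) | H x = g (x fun _ => false)} :=
      measurableSet_eq_fun hH (hg.comp (measurable_pi_apply _))
    rw [← hglue.map_eq, ae_map_iff hglue.measurable.aemeasurable hmeas]
    filter_upwards [hHG, hfst.quasiMeasurePreserving.ae hGg] with p h1 h2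
    rw [h1, h2]
    rfl

end FaceMaps

/-! ### The factor and the kernel of the seminorm. -/

section Factor

variable {X : Type*} [MeasurableSpace X] [StandardBorelSpace X] {μ : Measure X}
  [IsProbabilityMeasure μ] {T : X → X}

theorem factorAlgebra_le (T : X → X) (μ : Measure X) [IsProbabilityMeasure μ] (k : ℕ) :
    factorAlgebra T μ k ≤ ‹MeasurableSpace X› :=
  fun _ hA => hA.1

/-- The projection of the cube space to the coordinates other than `00⋯0`. -/
def starProj {X : Type*} (k : ℕ) (x : Cube X k) : StarVertex k → X := fun ε => x ε.1

theorem measurable_starProj {X : Type*} [MeasurableSpace X] (k : ℕ) :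
    Measurable (starProj (X := X) k) :=
  measurable_pi_lambda _ fun ε => measurable_pi_apply ε.1

theorem comap_starProj_le {X : Type*} [MeasurableSpace X] (k : ℕ) :
    MeasurableSpace.comap (starProj (X := X) k) MeasurableSpace.pi ≤ MeasurableSpace.pi :=
  (measurable_starProj k).comap_le

theorem measurable_faceMap_comap {X : Type*} [MeasurableSpace X] {T : X → X} (hT : Measurable T)
    (k : ℕ) (i : Fin k) :
    Measurable[MeasurableSpace.comap (starProj (X := X) k) MeasurableSpace.pi,
      MeasurableSpace.comap (starProj (X := X) k) MeasurableSpace.pi] (faceMap T k i) := by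
  rw [measurable_comap_iff]
  have : starProj k ∘ faceMap T k i
      = (fun (y : StarVertex k → X) ε => bif ε.1 i then T (y ε) else y ε) ∘ starProj k := rfl
  rw [this]
  refine Measurable.comp ?_ (comap_measurable _)
  refine measurable_pi_lambda _ fun ε => ?_
  cases ε.1 i
  · exact measurable_pi_apply ε
  · exact hT.comp (measurable_pi_apply ε)

theorem integral_mul_condExp_of_stronglyMeasurable {Ω : Type*} {m : MeasurableSpace Ω}
    [mΩ : MeasurableSpace Ω] {ν : Measure Ω} [IsProbabilityMeasure ν] (hm : m ≤ mΩ) {F Y : Ω → ℝ}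
    (hF : MemLp F 2 ν) (hY : StronglyMeasurable[m] Y) (hY2 : MemLp Y 2 ν) :
    ∫ x, Y x * (ν[F | m]) x ∂ν = ∫ x, Y x * F x ∂ν := by
  have h := condExp_mul_of_stronglyMeasurable_left (m := m) (μ := ν) (f := Y) (g := F)
    hY (hY2.integrable_mul hF) (hF.integrable one_le_two)
  rw [← integral_condExp hm (f := fun x => Y x * F x)]
  exact (integral_congr_ae h).symm

/-- A face map `φ` fixes the coordinate `00⋯0` and acts on the others among themselves. For the
conditional expectation `h`, the integrals of `(h ∘ φ) h`, `(h ∘ φ)²` and `h²` therefore agree, so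
`h ∘ φ - h` has norm 0. -/
theorem condExp_starProj_comp_faceMap_ae_eq (hT : MeasurePreserving T μ μ) (k : ℕ) (i : Fin k)
    {f : X → ℝ} (hf : Measurable f) {C : ℝ} (hC : ∀ x, |f x| ≤ C) :
    ∀ᵐ x ∂(cubeMeasure T μ k),
      ((cubeMeasure T μ k)[fun x => f (x fun _ => false)
        | MeasurableSpace.comap (starProj k) MeasurableSpace.pi]) (faceMap T k i x)
      = ((cubeMeasure T μ k)[fun x => f (x fun _ => false)
        | MeasurableSpace.comap (starProj k) MeasurableSpace.pi]) x := by
  have hm := comap_starProj_le (X := X) k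
  have hφ := measurePreserving_faceMap hT k i
  have hF : MemLp (fun x : Cube X k => f (x fun _ => false)) 2 (cubeMeasure T μ k) :=
    memLp_of_abs_le (hf.comp (measurable_pi_apply _)) (fun x => hC _) 2
  set h := (cubeMeasure T μ k)[fun x => f (x fun _ => false)
        | MeasurableSpace.comap (starProj k) MeasurableSpace.pi]
  have hh : StronglyMeasurable[MeasurableSpace.comap (starProj k) MeasurableSpace.pi] h :=
    stronglyMeasurable_condExp
  have hh2 : MemLp h 2 (cubeMeasure T μ k) := hF.condExp one_le_two
  have hhφ : StronglyMeasurable[MeasurableSpace.comap (starProj k) MeasurableSpace.pi]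
      (h ∘ faceMap T k i) := hh.comp_measurable (measurable_faceMap_comap hT.measurable k i)
  have hhφ2 := hh2.comp_measurePreserving hφ
  have e1 : ∫ x, h (faceMap T k i x) * h x ∂(cubeMeasure T μ k)
      = ∫ x, h x * h x ∂(cubeMeasure T μ k) := by
    rw [integral_mul_condExp_of_stronglyMeasurable hm hF hh hh2]
    refine (integral_mul_condExp_of_stronglyMeasurable hm hF hhφ hhφ2).trans ?_
    refine Eq.trans ?_ (integral_comp_of_measurePreserving hφ
      (g := fun x => h x * f (x fun _ => false))
      (hh2.aestronglyMeasurable.mul hF.aestronglyMeasurable))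
    rfl
  have e2 : ∫ x, h (faceMap T k i x) * h (faceMap T k i x) ∂(cubeMeasure T μ k)
      = ∫ x, h x * h x ∂(cubeMeasure T μ k) :=
    integral_comp_of_measurePreserving hφ (g := fun x => h x * h x)
      (hh2.aestronglyMeasurable.mul hh2.aestronglyMeasurable)
  have i1 : Integrable (fun x => h (faceMap T k i x) * h x) (cubeMeasure T μ k) :=
    hhφ2.integrable_mul hh2
  have i2 : Integrable (fun x => h (faceMap T k i x) * h (faceMap T k i x)) (cubeMeasure T μ k) :=
    hhφ2.integrable_mul hhφ2
  have i3 : Integrable (fun x => h x * h x) (cubeMeasure T μ k) := hh2.integrable_mul hh2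
  have e3 : ∫ x, (h (faceMap T k i x) - h x) ^ 2 ∂(cubeMeasure T μ k) = 0 := by
    have : ∀ x, (h (faceMap T k i x) - h x) ^ 2 = h (faceMap T k i x) * h (faceMap T k i x)
        - 2 * (h (faceMap T k i x) * h x) + h x * h x := fun x => by ring
    simp_rw [this]
    have i4 : Integrable (fun x => h (faceMap T k i x) * h (faceMap T k i x)
        - 2 * (h (faceMap T k i x) * h x)) (cubeMeasure T μ k) := i2.sub (i1.const_mul 2)
    rw [integral_add i4 i3, integral_sub i2 (i1.const_mul 2),
      integral_const_mul, e1, e2]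
    ring
  have i5 : Integrable (fun x => (h (faceMap T k i x) - h x) ^ 2) (cubeMeasure T μ k) :=
    (hhφ2.sub hh2).integrable_sq
  rw [integral_eq_zero_iff_of_nonneg (fun x => sq_nonneg _) i5] at e3
  filter_upwards [e3] with x hx
  simpa [sub_eq_zero] using hx

theorem prod_eq_mul_prod_starVertex {k : ℕ} (v : (Fin k → Bool) → ℝ) :
    ∏ ε, v ε = v (fun _ => false) * ∏ ε : StarVertex k, v ε.1 :=
  Fintype.prod_eq_mul_prod_subtype_ne v _

/-- The projection `h` of `f(x_{0⋯0})` onto the other coordinates has the form `g(x_{0⋯0})` with `g`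
measurable for the factor. So the integral of `h²` is that of `g f`, which is 0; then `h = 0`, and
the product over the other vertices is orthogonal to `f(x_{0⋯0})`. -/
theorem integral_prod_cube_eq_zero_of_condExp_factorAlgebra (hT : MeasurePreserving T μ μ)
    (k : ℕ) {f : X → ℝ} (hf : Measurable f) {C : ℝ} (hC : ∀ x, |f x| ≤ C)
    (h0 : μ[f | factorAlgebra T μ k] =ᵐ[μ] 0) :
    ∫ x, ∏ ε, f (x ε) ∂(cubeMeasure T μ (k + 1)) = 0 := by
  have hm := comap_starProj_le (X := X) (k + 1)
  have hF : MemLp (fun x : Cube X (k + 1) => f (x fun _ => false)) 2 (cubeMeasure T μ (k + 1)) :=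
    memLp_of_abs_le (hf.comp (measurable_pi_apply _)) (fun x => hC _) 2
  have hface := fun i => condExp_starProj_comp_faceMap_ae_eq hT (k + 1) i hf hC
  set h := (cubeMeasure T μ (k + 1))[fun x => f (x fun _ => false)
        | MeasurableSpace.comap (starProj (k + 1)) MeasurableSpace.pi]
  have hh : StronglyMeasurable[MeasurableSpace.comap (starProj (k + 1)) MeasurableSpace.pi] h :=
    stronglyMeasurable_condExp
  have hh2 : MemLp h 2 (cubeMeasure T μ (k + 1)) := hF.condExp one_le_two
  have hbd : ∀ᵐ x ∂(cubeMeasure T μ (k + 1)), |h x| ≤ C :=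
    ae_bdd_abs_condExp_of_ae_bdd_abs (ae_of_all _ fun x => hC _)
  have hC0 : 0 ≤ C := by
    obtain ⟨x⟩ := nonempty_of_isProbabilityMeasure μ
    exact (abs_nonneg _).trans (hC x)
  obtain ⟨g, hg, hgC, hhg⟩ : ∃ g : X → ℝ, Measurable g ∧ (∀ x, |g x| ≤ C) ∧
      ∀ᵐ x ∂(cubeMeasure T μ (k + 1)), h x = g (x fun _ => false) := by
    -- Truncation is needed because `h` is bounded only almost everywhere.
    obtain ⟨g, hg, hgC, hhg⟩ := exists_ae_eq_comp_eval_of_faceMap_invariant hT (C := C) (k + 1)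
      (H := fun x => max (-C) (min C (h x)))
      (measurable_const.max (measurable_const.min (hh.mono hm).measurable))
      (fun x => abs_le.2 ⟨le_max_left _ _, max_le (by linarith) (min_le_left _ _)⟩)
      (fun i => by filter_upwards [hface i] with x hx; rw [hx])
    refine ⟨g, hg, hgC, ?_⟩
    filter_upwards [hhg, hbd] with x h1 h2
    rw [← h1, min_eq_right (abs_le.1 h2).2, max_eq_right (abs_le.1 h2).1]
  have hgZ : Measurable[factorAlgebra T μ k] g := by
    intro A hA
    refine ⟨hg hA, ?_⟩
    obtain ⟨B, hB, hBA⟩ := hh.measurable hA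
    refine ⟨B, hB, ?_⟩
    filter_upwards [hhg] with x hx
    have h1 : x ∈ starProj (k + 1) ⁻¹' B ↔ x ∈ h ⁻¹' A := by rw [hBA]
    rw [Set.mem_preimage, Set.mem_preimage, hx] at h1
    exact h1.symm
  have hgf : ∫ x, g x * f x ∂μ = 0 := by
    rw [← integral_mul_condExp_of_stronglyMeasurable (factorAlgebra_le T μ k)
      (memLp_of_abs_le hf hC 2) hgZ.stronglyMeasurable (memLp_of_abs_le hg hgC 2)]
    refine (integral_congr_ae (g := fun _ => 0) ?_).trans (by simp)
    filter_upwards [h0] with x hx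
    simp [hx]
  have hhh : ∫ x, h x * h x ∂(cubeMeasure T μ (k + 1)) = 0 := by
    rw [integral_mul_condExp_of_stronglyMeasurable hm hF hh hh2, ← hgf]
    refine Eq.trans ?_ (integral_comp_of_measurePreserving
      (measurePreserving_eval T μ (k + 1) fun _ => false) (g := fun x => g x * f x)
      (hg.mul hf).aestronglyMeasurable)
    refine integral_congr_ae ?_
    filter_upwards [hhg] with x hx
    rw [hx]
  rw [integral_eq_zero_iff_of_nonneg (fun x => mul_self_nonneg _) (hh2.integrable_mul hh2)] at hhh
  set Q : Cube X (k + 1) → ℝ := fun x => ∏ ε : StarVertex (k + 1), f (starProj (k + 1) x ε)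
  have hQ : StronglyMeasurable[MeasurableSpace.comap (starProj (k + 1)) MeasurableSpace.pi] Q := by
    refine Measurable.stronglyMeasurable ?_
    have hQ' : Measurable fun y : StarVertex (k + 1) → X => ∏ ε, f (y ε) :=
      Finset.measurable_prod _ fun ε _ => hf.comp (measurable_pi_apply ε)
    exact hQ'.comp (comap_measurable _)
  have hQ2 : MemLp Q 2 (cubeMeasure T μ (k + 1)) := by
    refine memLp_of_abs_le (hQ.mono hm).measurable (C := ∏ _ε : StarVertex (k + 1), C)
      (fun x => ?_) 2
    simp only [Q]
    rw [Finset.abs_prod]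
    exact Finset.prod_le_prod (fun _ _ => abs_nonneg _) fun ε _ => hC _
  have hfin : ∫ x, ∏ ε, f (x ε) ∂(cubeMeasure T μ (k + 1))
      = ∫ x, Q x * f (x fun _ => false) ∂(cubeMeasure T μ (k + 1)) := by
    congr 1
    funext x
    rw [prod_eq_mul_prod_starVertex (fun ε => f (x ε)), mul_comm]
    rfl
  rw [hfin, ← integral_mul_condExp_of_stronglyMeasurable hm hF hQ hQ2]
  refine (integral_congr_ae (g := fun _ => 0) ?_).trans (by simp)
  filter_upwards [hhh] with x hx
  have : h x = 0 := by simpa using hx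
  change Q x * h x = 0
  rw [this, mul_zero]

/-- The Cauchy–Schwarz–Gowers inequality with indicators at the other vertices makes `f(x_{0⋯0})`
integrate to 0 over boxes in those coordinates, hence over all measurable sets of them. Sets of the
factor are of this kind. -/
theorem condExp_factorAlgebra_ae_eq_zero (hT : MeasurePreserving T μ μ)
    (k : ℕ) {f : X → ℝ} (hf : Measurable f) {C : ℝ} (hC : ∀ x, |f x| ≤ C)
    (h0 : ∫ x, ∏ ε, f (x ε) ∂(cubeMeasure T μ (k + 1)) = 0) :
    μ[f | factorAlgebra T μ k] =ᵐ[μ] 0 := by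
  have hFi : Integrable (fun x : Cube X (k + 1) => f (x fun _ => false))
      (cubeMeasure T μ (k + 1)) :=
    (memLp_of_abs_le (hf.comp (measurable_pi_apply _)) (fun x => hC _) 1).integrable le_rfl
  have hstar := measurable_starProj (X := X) (k + 1)
  have hbox : ∀ s : StarVertex (k + 1) → Set X, (∀ ε, MeasurableSet (s ε)) →
      ∫ x in starProj (k + 1) ⁻¹' (Set.univ.pi s), f (x fun _ => false)
        ∂(cubeMeasure T μ (k + 1)) = 0 := by
    classical
    intro s hs
    set v : (Fin (k + 1) → Bool) → X → ℝ := fun ε =>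
      if h : ε = fun _ => false then f else (s ⟨ε, h⟩).indicator fun _ => 1
    have hv0 : v (fun _ => false) = f := by simp [v]
    have hv1 : ∀ ε : StarVertex (k + 1), v ε.1 = (s ε).indicator fun _ => 1 := fun ε => by
      simp only [v]
      rw [dif_neg ε.2]
    have hvm : ∀ ε, Measurable (v ε) := by
      intro ε
      by_cases h : ε = fun _ => false
      · rw [h, hv0]
        exact hf
      · rw [hv1 ⟨ε, h⟩]
        exact measurable_const.indicator (hs _)
    have hgcs := abs_integral_prod_cube_pow_le (T := T) (μ := μ) hT k hvm (C := C)
      (by rw [hv0]; exact hC) fun ε h x => by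
        rw [hv1 ⟨ε, h⟩]
        by_cases hx : x ∈ s ⟨ε, h⟩ <;> simp [hx]
    rw [hv0, h0] at hgcs
    have hz : ∫ x, ∏ ε, v ε (x ε) ∂(cubeMeasure T μ (k + 1)) = 0 := by
      have := le_antisymm hgcs (by positivity)
      exact abs_eq_zero.1 (pow_eq_zero_iff (by positivity) |>.1 this)
    rw [← hz, ← integral_indicator (hstar (MeasurableSet.univ_pi hs))]
    congr 1
    funext x
    rw [prod_eq_mul_prod_starVertex (fun ε => v ε (x ε)), hv0]
    simp_rw [hv1]
    by_cases hx : x ∈ starProj (k + 1) ⁻¹' (Set.univ.pi s)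
    · rw [Set.indicator_of_mem hx, Finset.prod_eq_one, mul_one]
      intro ε _
      exact Set.indicator_of_mem (hx ε trivial) _
    · rw [Set.indicator_of_notMem hx]
      have : ∃ ε, x ε.1 ∉ s ε := by
        by_contra! h
        exact hx fun ε _ => h ε
      obtain ⟨ε, hε⟩ := this
      rw [Finset.prod_eq_zero (Finset.mem_univ ε) (Set.indicator_of_notMem hε _), mul_zero]
  have hall : ∀ B : Set (StarVertex (k + 1) → X), MeasurableSet B →
      ∫ x in starProj (k + 1) ⁻¹' B, f (x fun _ => false) ∂(cubeMeasure T μ (k + 1)) = 0 := by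
    have huniv : ∫ x, f (x fun _ => false) ∂(cubeMeasure T μ (k + 1)) = 0 := by
      simpa using hbox (fun _ => Set.univ) fun _ => MeasurableSet.univ
    refine MeasurableSpace.induction_on_inter generateFrom_pi.symm isPiSystem_pi ?_ ?_ ?_ ?_
    · simp
    · rintro _ ⟨s, hs, rfl⟩
      exact hbox s fun ε => hs ε trivial
    · intro B hB h
      rw [Set.preimage_compl, setIntegral_compl (hstar hB) hFi, h, huniv, sub_zero]
    · intro B hd hB h
      rw [Set.preimage_iUnion, integral_iUnion (fun n => hstar (hB n))
        (fun i j hij => (hd hij).preimage _) hFi.integrableOn]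
      simp [h]
  refine (ae_eq_condExp_of_forall_setIntegral_eq (factorAlgebra_le T μ k)
    ((memLp_of_abs_le hf hC 1).integrable le_rfl) (fun _ _ _ => by simp [IntegrableOn]) ?_
    aestronglyMeasurable_const).symm
  rintro A ⟨hA, B, hB, hAB⟩ _
  have hev := measurePreserving_eval T μ (k + 1) fun _ => false
  rw [← integral_indicator hA, ← integral_indicator hA,
    ← integral_comp_of_measurePreserving hev (hf.indicator hA).aestronglyMeasurable]
  have h1 : ∫ x : Cube X (k + 1), A.indicator f (x fun _ => false) ∂(cubeMeasure T μ (k + 1))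
      = ∫ x in starProj (k + 1) ⁻¹' B, f (x fun _ => false) ∂(cubeMeasure T μ (k + 1)) := by
    rw [← integral_indicator (hstar hB)]
    refine integral_congr_ae ?_
    filter_upwards [hAB] with x hx
    by_cases hxA : (x fun _ => false) ∈ A
    · have hxB : x ∈ starProj (k + 1) ⁻¹' B := hx.1 hxA
      rw [Set.indicator_of_mem hxA, Set.indicator_of_mem hxB]
    · have hxB : x ∉ starProj (k + 1) ⁻¹' B := mt hx.2 hxA
      rw [Set.indicator_of_notMem hxA, Set.indicator_of_notMem hxB]
  rw [h1, hall B hB]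
  refine (integral_congr_ae (g := fun _ => (0 : ℝ)) (ae_of_all _ fun x => ?_)).trans (by simp)
  exact Set.indicator_apply_eq_zero.2 fun _ => rfl

/-- Invertible maps commuting with `T` preserve the factors of `T`. -/
theorem comap_factorAlgebra_eq (hT : MeasurePreserving T μ μ) {S : X ≃ᵐ X}
    (hS : MeasurePreserving S μ μ) (hST : Function.Commute S T) (k : ℕ) :
    (factorAlgebra T μ k).comap S = factorAlgebra T μ k := by
  have key : ∀ {S : X → X}, MeasurePreserving S μ μ → Function.Commute S T → ∀ A,
      MeasurableSet[factorAlgebra T μ k] A → MeasurableSet[factorAlgebra T μ k] (S ⁻¹' A) := by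
    rintro S hS hST A ⟨hA, B, hB, hAB⟩
    refine ⟨hS.measurable hA, (fun y ε => S (y ε)) ⁻¹' B, ?_, ?_⟩
    · exact (measurable_pi_lambda _ fun ε => hS.measurable.comp (measurable_pi_apply ε)) hB
    · exact (measurePreserving_cubeMap hT hS hST (k + 1)).1.quasiMeasurePreserving.ae hAB
  refine le_antisymm ?_ ?_
  · rintro _ ⟨A, hA, rfl⟩
    exact key hS hST A hA
  · intro A hA
    refine ⟨S.symm ⁻¹' A, key (hS.symm S) ?_ A hA, ?_⟩
    · intro y
      apply S.injective
      have := hST (S.symm y)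
      simp only [MeasurableEquiv.apply_symm_apply] at this ⊢
      exact this.symm
    · ext x
      simp

end Factor

end HostKra

namespace HostKra

/-! ### Bounded representatives. -/

section Representatives

variable {X : Type*} [MeasurableSpace X] {μ : Measure X}

/-- Truncating at the essential supremum gives the everywhere bound that the cube estimates assume,
without loss in the constant. -/
theorem exists_measurable_ae_eq_of_memLp_top {f : X → ℝ} (hf : MemLp f ⊤ μ) :
    ∃ g : X → ℝ, Measurable g ∧ f =ᵐ[μ] g ∧ ∀ x, |g x| ≤ (eLpNorm f ⊤ μ).toReal := by
  set C := (eLpNorm f ⊤ μ).toReal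
  have hC : 0 ≤ C := ENNReal.toReal_nonneg
  refine ⟨fun x => max (-C) (min C (hf.1.mk f x)), measurable_const.max
    (measurable_const.min hf.1.stronglyMeasurable_mk.measurable), ?_, fun x =>
    abs_le.2 ⟨le_max_left _ _, max_le (by linarith) (min_le_left _ _)⟩⟩
  filter_upwards [hf.1.ae_eq_mk, ae_le_eLpNormEssSup (f := f) (μ := μ)] with x h1 h2
  have h3 : |f x| ≤ C := by
    rw [← eLpNorm_exponent_top] at h2
    have := ENNReal.toReal_mono hf.2.ne h2
    rwa [toReal_enorm, Real.norm_eq_abs] at this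
  rw [← h1, min_eq_right (abs_le.1 h3).2, max_eq_right (abs_le.1 h3).1]

theorem multAverage_ae_eq {l : ℕ} {T : Fin l → X → X} (hT : ∀ i, MeasurePreserving (T i) μ μ)
    {f g : Fin l → X → ℝ} (hfg : ∀ i, f i =ᵐ[μ] g i) (N : ℕ) :
    multAverage T f N =ᵐ[μ] multAverage T g N := by
  have h : ∀ᵐ x ∂μ, ∀ (n : ℕ) i, f i ((T i)^[n] x) = g i ((T i)^[n] x) :=
    ae_all_iff.2 fun n => ae_all_iff.2 fun i =>
      ((hT i).iterate n).quasiMeasurePreserving.ae (hfg i)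
  filter_upwards [h] with x hx
  simp only [multAverage, hx]

theorem measurable_multAverage {l : ℕ} {T : Fin l → X → X} (hT : ∀ i, Measurable (T i))
    {f : Fin l → X → ℝ} (hf : ∀ i, Measurable (f i)) (N : ℕ) : Measurable (multAverage T f N) :=
  measurable_const.mul (Finset.measurable_sum _ fun n _ => Finset.measurable_prod _ fun i _ =>
    (hf i).comp ((hT i).iterate n))

theorem abs_multAverage_le {X : Type*} {l : ℕ} {T : Fin l → X → X} {f : Fin l → X → ℝ} {C : Fin l → ℝ}
    (hC : ∀ i x, |f i x| ≤ C i) (N : ℕ) (x : X) : |multAverage T f N x| ≤ ∏ i, C i := by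
  have h0 : 0 ≤ ∏ i, C i := Finset.prod_nonneg fun i _ => (abs_nonneg _).trans (hC i x)
  rcases Nat.eq_zero_or_pos N with rfl | hN
  · simpa [multAverage] using h0
  have hN' : (0 : ℝ) < N := by exact_mod_cast hN
  rw [multAverage, abs_mul, abs_of_nonneg (by positivity), one_div, inv_mul_le_iff₀ hN']
  refine (Finset.abs_sum_le_sum_abs _ _).trans ?_
  refine (Finset.sum_le_card_nsmul _ _ (∏ i, C i) fun n _ => ?_).trans (by simp)
  rw [Finset.abs_prod]
  exact Finset.prod_le_prod (fun _ _ => abs_nonneg _) fun i _ => hC i _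

theorem eLpNorm_two_le_ofReal {g : X → ℝ} (hg : MemLp g 2 μ) {c : ℝ} (hc : 0 ≤ c)
    (h : ∫ x, g x ^ 2 ∂μ ≤ c ^ 2) : eLpNorm g 2 μ ≤ ENNReal.ofReal c := by
  rw [hg.eLpNorm_eq_integral_rpow_norm (by norm_num) (by norm_num)]
  refine ENNReal.ofReal_le_ofReal ?_
  simp only [ENNReal.toReal_ofNat, Real.rpow_ofNat, Real.norm_eq_abs, sq_abs]
  rw [← one_div, ← Real.sqrt_eq_rpow]
  exact Real.sqrt_le_iff.2 ⟨hc, h⟩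

end Representatives

/-! ### Conclusions for functions in L^∞. -/

section Main

variable {X : Type*} [MeasurableSpace X] [StandardBorelSpace X] {μ : Measure X}
  [IsProbabilityMeasure μ]

/-- Every coordinate has law `μ` under the cube measure, so null sets pull back to null sets. -/
theorem seminorm_congr_ae (T : X → X) (k : ℕ) {f g : X → ℝ} (hfg : f =ᵐ[μ] g) :
    seminorm T μ k f = seminorm T μ k g := by
  unfold seminorm
  congr 1
  refine integral_congr_ae ?_
  filter_upwards [ae_all_iff.2 fun ε =>
    (measurePreserving_eval T μ k ε).quasiMeasurePreserving.ae hfg] with x hx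
  simp only [hx]

theorem limsup_eLpNorm_multAverage_le {l : ℕ} {T : Fin l → X ≃ᵐ X}
    (hcomm : ∀ i j, Function.Commute (T i) (T j)) (herg : ∀ i, Ergodic (T i) μ)
    (hpair : ∀ i j, i ≠ j → Ergodic (fun x => T i ((T j).symm x)) μ) (i j : Fin l)
    {f : Fin l → X → ℝ} (hf : ∀ i, MemLp (f i) ⊤ μ) :
    limsup (fun N => eLpNorm (multAverage (fun i => T i) f N) 2 μ) atTop
      ≤ ENNReal.ofReal (seminorm (T j) μ l (f i)) *
          ∏ m ∈ Finset.univ.erase i, eLpNorm (f m) ⊤ μ := by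
  have hmp := fun i => (herg i).toMeasurePreserving
  choose g hg hfg hgC using fun i => exists_measurable_ae_eq_of_memLp_top (hf i)
  set C : Fin l → ℝ := fun m => (eLpNorm (f m) ⊤ μ).toReal
  set P : ℝ := (∏ m ∈ Finset.univ.erase i, C m) * seminorm (T j) μ l (f i)
  have hprod : 0 ≤ ∏ m ∈ Finset.univ.erase i, C m :=
    Finset.prod_nonneg fun m _ => ENNReal.toReal_nonneg
  have hP : 0 ≤ P := mul_nonneg hprod (by
    rw [seminorm_congr_ae (T j) l (hfg i)]
    exact seminorm_nonneg _ _ i.pos.ne' (hg i) (hgC i))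
  have hrhs : ENNReal.ofReal (seminorm (T j) μ l (f i)) *
      ∏ m ∈ Finset.univ.erase i, eLpNorm (f m) ⊤ μ = ENNReal.ofReal P := by
    rw [ENNReal.ofReal_mul hprod, mul_comm, ENNReal.ofReal_prod_of_nonneg fun m _ =>
      ENNReal.toReal_nonneg]
    congr 1
    exact Finset.prod_congr rfl fun m _ => (ENNReal.ofReal_toReal (hf m).2.ne).symm
  rw [hrhs]
  refine ENNReal.le_of_forall_pos_le_add fun δ hδ _ => ?_
  refine limsup_le_of_le (h := ?_)
  have hδ' : (0 : ℝ) < δ := hδ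
  -- The error is chosen so that the total bound is `(P + δ) ^ 2`.
  have hev := eventually_integral_sq_multiple_average_le (μ := μ) (l - 1) Finset.univ T g C i
    ((P + δ) ^ 2 - P ^ 2) (by
      have := i.pos
      rw [Finset.card_univ, Fintype.card_fin]
      omega)
    (fun a _ b _ => hcomm a b) (fun a _ => herg a) (fun a _ b _ hab => hpair a b hab) hg hgC
    (Finset.mem_univ i) (by nlinarith)
  have hl : l - 1 + 1 = l := Nat.succ_pred_eq_of_pos i.pos
  filter_upwards [hev] with N hN
  -- The bound comes with the seminorm of `T i`; it is the same for every `T j`.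
  rw [hl, seminorm_eq_of_commute (herg i) (herg j) (hcomm j i) l,
    ← seminorm_congr_ae (T j) l (hfg i)] at hN
  rw [eLpNorm_congr_ae (multAverage_ae_eq hmp hfg N), ← ENNReal.ofReal_coe_nnreal,
    ← ENNReal.ofReal_add hP hδ'.le]
  refine eLpNorm_two_le_ofReal (memLp_of_abs_le
    (measurable_multAverage (fun i => (hmp i).measurable) hg N)
    (abs_multAverage_le hgC N) 2) (by positivity) ?_
  simp only [multAverage, one_div]
  linarith

theorem condExp_factorAlgebra_ae_eq_zero_iff {T : X → X} (hT : MeasurePreserving T μ μ) (k : ℕ)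
    {f : X → ℝ} (hf : MemLp f ⊤ μ) :
    μ[f | factorAlgebra T μ k] =ᵐ[μ] 0 ↔ seminorm T μ (k + 1) f = 0 := by
  obtain ⟨g, hg, hfg, hgC⟩ := exists_measurable_ae_eq_of_memLp_top hf
  have hc : μ[f | factorAlgebra T μ k] =ᵐ[μ] μ[g | factorAlgebra T μ k] := condExp_congr_ae hfg
  have hpow := seminorm_pow T μ (Nat.succ_ne_zero k) hg hgC
  rw [seminorm_congr_ae T (k + 1) hfg]
  refine ⟨fun h => ?_, fun h => hc.trans ?_⟩
  · have := integral_prod_cube_eq_zero_of_condExp_factorAlgebra hT k hg hgC (hc.symm.trans h)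
    rw [this] at hpow
    exact (pow_eq_zero_iff (by positivity)).1 hpow
  · refine condExp_factorAlgebra_ae_eq_zero hT k hg hgC ?_
    rw [← hpow]
    show seminorm T μ (k + 1) g ^ 2 ^ (k + 1) = 0
    rw [h, zero_pow (by positivity)]

theorem isCharacteristic_factorAlgebra {l : ℕ} {T : Fin l → X ≃ᵐ X}
    (hcomm : ∀ i j, Function.Commute (T i) (T j)) (herg : ∀ i, Ergodic (T i) μ)
    (hpair : ∀ i j, i ≠ j → Ergodic (fun x => T i ((T j).symm x)) μ) (j : Fin l) :
    IsCharacteristic (factorAlgebra (T j) μ (l - 1)) (fun i => T i) μ := by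
  refine ⟨factorAlgebra_le _ _ _, fun i => comap_factorAlgebra_eq (herg j).toMeasurePreserving
    (herg i).toMeasurePreserving (hcomm i j) _, fun f hf ⟨i, hi⟩ => ?_⟩
  rw [condExp_factorAlgebra_ae_eq_zero_iff (herg j).toMeasurePreserving (l - 1) (hf i),
    show l - 1 + 1 = l from Nat.succ_pred_eq_of_pos i.pos] at hi
  have h := limsup_eLpNorm_multAverage_le hcomm herg hpair i j hf
  rw [hi, ENNReal.ofReal_zero, zero_mul] at h
  exact tendsto_of_le_liminf_of_limsup_le bot_le h

end Main

end HostKra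
theorem mainTheorem5 {X : Type*} [MeasurableSpace X] [StandardBorelSpace X]
    (μ : Measure X) [IsProbabilityMeasure μ]
    (l : ℕ) (hl : 1 ≤ l) (T : Fin l → X ≃ᵐ X)
    (hcomm : ∀ i j, Function.Commute (T i) (T j))
    (herg : ∀ i, Ergodic (T i) μ)
    (hpair : ∀ i j, i ≠ j → Ergodic (fun x => T i ((T j).symm x)) μ) :
    (∀ j : Fin l,
      (∀ f : Fin l → X → ℝ, (∀ i, MemLp (f i) ⊤ μ) →
        limsup (fun N => eLpNorm (HostKra.multAverage (fun i => T i) f N) 2 μ) atTop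
          ≤ ⨅ i, ENNReal.ofReal (HostKra.seminorm (T j) μ l (f i)) *
              ∏ m ∈ Finset.univ.erase i, eLpNorm (f m) ⊤ μ) ∧
      (∀ f : Fin l → X → ℝ, (∀ i, MemLp (f i) ⊤ μ) → (∀ i, eLpNorm (f i) ⊤ μ ≤ 1) →
        limsup (fun N => eLpNorm (HostKra.multAverage (fun i => T i) f N) 2 μ) atTop
          ≤ ENNReal.ofReal (⨅ i, HostKra.seminorm (T j) μ l (f i)))) ∧
    (∀ j : Fin l,
      (∀ f : X → ℝ, MemLp f ⊤ μ →
        (μ[f | HostKra.factorAlgebra (T j) μ (l - 1)] =ᵐ[μ] 0 ↔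
          HostKra.seminorm (T j) μ l f = 0)) ∧
      HostKra.IsCharacteristic (HostKra.factorAlgebra (T j) μ (l - 1)) (fun i => T i) μ) := by
  have hi0 : Nonempty (Fin l) := ⟨⟨0, hl⟩⟩
  refine ⟨fun j => ⟨fun f hf => le_iInf fun i =>
    HostKra.limsup_eLpNorm_multAverage_le hcomm herg hpair i j hf, fun f hf hf1 => ?_⟩,
    fun j => ⟨fun f hf => ?_, HostKra.isCharacteristic_factorAlgebra hcomm herg hpair j⟩⟩
  · obtain ⟨i, hi⟩ := exists_eq_ciInf_of_finite (f := fun i => HostKra.seminorm (T j) μ l (f i))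
    rw [← hi]
    refine (HostKra.limsup_eLpNorm_multAverage_le hcomm herg hpair i j hf).trans ?_
    exact mul_le_of_le_one_right' (Finset.prod_le_one' fun m _ => hf1 m)
  · have h := HostKra.condExp_factorAlgebra_ae_eq_zero_iff (herg j).toMeasurePreserving (l - 1) hf
    rwa [Nat.sub_add_cancel hl] at h
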